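/- **Setting.** Let $A\in\mathbb R^{p\times p}$, $B\in\mathbb R^{p\times q}$, $C_1,C_2\in\mathbb R^{m\times p}$, let $K,L_1,L_2$ be gains such that $A+BK$, $A+L_1C_1$, $A+L_2C_2$ are Schur stable, and for $\alpha\in\{0,1\}$ put $C(\alpha)=\alpha C_1+(1-\alpha)C_2$, $L(\alpha)=\alpha L_1+(1-\alpha)L_2$. Write $C=C_1$, $L=L_1$ and assume that $k'=\min\{k\ge 0: C(A+BK)^kB\neq 0\}$ exists. The process noise $(w_n)$, the measurement noises $(z_n)$, $(\eta_n)$ and the private excitation $(e_n)$ are each bounded, zero mean and i.i.d.; $w$ is independent of $(z,\eta)$, and $\Sigma_E=\mathbb E[e_0e_0^\top]$ is positive definite. With $u_n=Kx_n'+e_n$, the attacked closed loop is $$x_{n+1}=Ax_n+Bu_n+w_n,\qquad \tilde y_n=C(\alpha_n)x_n+\alpha_nz_n+(1-\alpha_n)\eta_n+\alpha_nv_n,$$ $$x'_{n+1}=Ax'_n+Bu_n+L(\alpha_n)\big(C(\alpha_n)x'_n-\tilde y_n\big).$$ A second observer always uses the vulnerable sensor $y_n=Cx_n+z_n+v_n$: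 $$\hat x_{n+1}=A\hat x_n+Bu_n+L(C\hat x_n-y_n),\qquad \hat x_0=x_0.$$ Let $\delta_0=0$, $\delta_{n+1}=(A+LC)\delta_n-w_n-Lz_n$ be its attack-free error and, for $N\ge 1$ (with $e_j=0$ for $j<0$), $$\Phi^{(1)}_N=\frac1N\sum_{n=0}^{N-1}(C\hat x_n-y_n)(C\hat x_n-y_n)^\top-\frac1N\sum_{n=0}^{N-1}\mathbb E\big[(C\delta_n-z_n)(C\delta_n-z_n)^\top\big],\qquad \Phi^{(2)}_N=\frac1N\sum_{n=0}^{N-1}(C\hat x_n-y_n)e_{n-k'-1}^\top .$$ Let $\rho,S>0$, $t_N=\sqrt{(1+\rho)S\log N/N}$, and let $$E_N=\{\|\Phi^{(1)}_N\|>t_N\}\cup\{\|\Phi^{(2)}_N\|>t_N\}$$ (spectral norm) be the event that an attack is reported at time $N$. Let $\tau\ge 1$ be an integer. The switching signal has $\alpha_0=1$ and, for $N\ge 1$: $\alpha_N=0$ if $\|\Phi_N^{(1)}\|\ge t_N$ or $\|\Phi_N^{(2)}\|\ge t_N$; otherwise $\alpha_N=1$ if $N\ge\tau$ and $\alpha_{N-1}=\dots=\alpha_{N-\tau}=0$;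 otherwise $\alpha_N=\alpha_{N-1}$. **Attack.** For some $\gamma\in\mathbb R$, $$v_n=C\xi_n+\zeta_n-\gamma\,(Cx_n+z_n),\qquad \xi_{n+1}=(A+BK)\xi_n+\omega_n,$$ with bounded random sequences $(\omega_n)$, $(\zeta_n)$. The excitation is private: $(e_n)_n$ is independent of the initial conditions $x_0,x'_0,\xi_0$ and the sequences $(w_n,z_n,\eta_n,\omega_n,\zeta_n)_n$ together. The attack is nontrivial, i.e. it is not the case that almost surely $v_n=0$ for all $n$. If $\gamma=0$, assume in addition that the pairs $(\omega_n,\zeta_n)$ are zero mean and i.i.d. over $n$ and independent of $(w_n,z_n,\eta_n)_n$, and that either $\xi_0=0$ almost surely or $v$ does not have zero average power, i.e. it is not the case that $\frac1N\sum_{n=0}^{N-1}v_n^\top v_n\to0$ almost surely. **Theorem.** Then $\mathrm P\big(\limsup_{N\to\infty}\neg E_N\big)=0$; that is, almost surely the test fails to detect the attack only finitely many times. -/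

import Mathlib

open MeasureTheory ProbabilityTheory Filter Topology Matrix
open scoped Matrix.Norms.L2Operator

namespace Watermark

/-- Schur stability: every complex eigenvalue has modulus less than one. -/
def SchurStable {d : ℕ} (M : Matrix (Fin d) (Fin d) ℝ) : Prop :=
  ∀ l ∈ spectrum ℂ (M.map (algebraMap ℝ ℂ)), ‖l‖ < 1

/-- Plant matrices `A`, `B`, the two sensor matrices `C₁` (accurate, vulnerable) and `C₂` (secure),
the feedback gain `K` and the two observer gains. -/
structure Plant (p q m : ℕ) where
  A : Matrix (Fin p) (Fin p) ℝ
  B : Matrix (Fin p) (Fin q) ℝ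
  C₁ : Matrix (Fin m) (Fin p) ℝ
  C₂ : Matrix (Fin m) (Fin p) ℝ
  K : Matrix (Fin q) (Fin p) ℝ
  L₁ : Matrix (Fin p) (Fin m) ℝ
  L₂ : Matrix (Fin p) (Fin m) ℝ

namespace Plant

variable {p q m : ℕ}

/-- The gains are stabilizing. -/
structure Stable (P : Plant p q m) : Prop where
  feedback : SchurStable (P.A + P.B * P.K)
  observer₁ : SchurStable (P.A + P.L₁ * P.C₁)
  observer₂ : SchurStable (P.A + P.L₂ * P.C₂)

/-- `C(α) = α C₁ + (1 - α) C₂`. -/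
def C (P : Plant p q m) (a : ℝ) : Matrix (Fin m) (Fin p) ℝ := a • P.C₁ + (1 - a) • P.C₂

/-- `L(α) = α L₁ + (1 - α) L₂`. -/
def L (P : Plant p q m) (a : ℝ) : Matrix (Fin p) (Fin m) ℝ := a • P.L₁ + (1 - a) • P.L₂

/-- `k' = min {k ≥ 0 | C₁ (A + B K) ^ k B ≠ 0}`. -/
noncomputable def lag (P : Plant p q m) : ℕ :=
  sInf {k : ℕ | P.C₁ * (P.A + P.B * P.K) ^ k * P.B ≠ 0}

end Plant

/-- A process that is bounded, uniformly in time, almost surely. Boundedness does not depend on the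
norm, so the norm of the ambient finite-dimensional space is used. -/
def UniformlyBounded {Ω E : Type*} [MeasurableSpace Ω] [NormedAddCommGroup E]
    (μ : Measure Ω) (s : ℕ → Ω → E) : Prop :=
  ∃ R : ℝ, ∀ n, ∀ᵐ ω ∂μ, ‖s n ω‖ ≤ R

/-- Bounded, zero mean, independent and identically distributed random vectors. -/
structure IsWhiteNoise {Ω E : Type*} [MeasurableSpace Ω] [NormedAddCommGroup E] [NormedSpace ℝ E]
    [MeasurableSpace E] (μ : Measure Ω) (s : ℕ → Ω → E) : Prop where
  measurable : ∀ n, Measurable (s n)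
  bounded : UniformlyBounded μ s
  mean_zero : ∀ n, ∫ ω, s n ω ∂μ = 0
  indep : iIndepFun s μ
  identDistrib : ∀ n, IdentDistrib (s n) (s 0) μ μ

/-- The second moment matrix `E[ξ ξᵀ]` of a random vector (its covariance if it is centered). -/
noncomputable def secondMoment {Ω : Type*} [MeasurableSpace Ω] (μ : Measure Ω) {d : ℕ}
    (s : Ω → Fin d → ℝ) : Matrix (Fin d) (Fin d) ℝ :=
  Matrix.of fun i j => ∫ ω, s ω i * s ω j ∂μ

/-- The random inputs of the plant: process noise `w`, private excitation `e`, and the measurement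
noises `z` (of the vulnerable sensor `C₁`) and `η` (of the secure sensor `C₂`). -/
structure Inputs (Ω : Type*) (p q m : ℕ) where
  w : ℕ → Ω → Fin p → ℝ
  e : ℕ → Ω → Fin q → ℝ
  z : ℕ → Ω → Fin m → ℝ
  η : ℕ → Ω → Fin m → ℝ

structure Inputs.Admissible {Ω : Type*} [MeasurableSpace Ω] {p q m : ℕ}
    (I : Inputs Ω p q m) (μ : Measure Ω) : Prop where
  process : IsWhiteNoise μ I.w
  excitation : IsWhiteNoise μ I.e
  measurement₁ : IsWhiteNoise μ I.z
  measurement₂ : IsWhiteNoise μ I.η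
  excitation_cov : (secondMoment μ (I.e 0)).PosDef
  indep : IndepFun (fun ω n => I.w n ω) (fun ω n => (I.z n ω, I.η n ω)) μ

/-- The attacker's parameters: the gain `γ`, the disturbance `d` that drives the replayed dynamics
`ξ`, and the additive noise `ζ`. -/
structure Attack (Ω : Type*) (p m : ℕ) where
  γ : ℝ
  d : ℕ → Ω → Fin p → ℝ
  ζ : ℕ → Ω → Fin m → ℝ

/-- All signals of the attacked loop: state `x`, estimate `x'` of the switching observer, estimate
`xh` of the never switching observer, replayed state `ξ`, attack `v`, and switching signal `α`. -/
structure Signals (Ω : Type*) (p m : ℕ) where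
  x : ℕ → Ω → Fin p → ℝ
  x' : ℕ → Ω → Fin p → ℝ
  xh : ℕ → Ω → Fin p → ℝ
  ξ : ℕ → Ω → Fin p → ℝ
  v : ℕ → Ω → Fin m → ℝ
  α : ℕ → Ω → ℝ

section Tests

variable {Ω : Type*} {p q m : ℕ}

/-- The error of the never switching observer without attack:
`δ₀ = 0`, `δ_{n+1} = (A + L₁ C₁) δ_n - w_n - L₁ z_n`. -/
def nominalError (P : Plant p q m) (I : Inputs Ω p q m) : ℕ → Ω → Fin p → ℝ
  | 0, _ => 0
  | n + 1, ω => (P.A + P.L₁ * P.C₁) *ᵥ nominalError P I n ω - I.w n ω - P.L₁ *ᵥ I.z n ω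

/-- `y_n = C₁ x_n + z_n + v_n`, the measurement delivered by the vulnerable sensor. -/
def measurement (P : Plant p q m) (I : Inputs Ω p q m) (s : Signals Ω p m) (n : ℕ) (ω : Ω) :
    Fin m → ℝ :=
  P.C₁ *ᵥ s.x n ω + I.z n ω + s.v n ω

/-- The residual `C₁ x̂_n - y_n`. -/
def residual (P : Plant p q m) (I : Inputs Ω p q m) (s : Signals Ω p m) (n : ℕ) (ω : Ω) :
    Fin m → ℝ :=
  P.C₁ *ᵥ s.xh n ω - measurement P I s n ω

/-- `e_{n-k'-1}`, read as zero when the index is negative. -/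
noncomputable def delayedExcitation (P : Plant p q m) (I : Inputs Ω p q m) (n : ℕ) (ω : Ω) :
    Fin q → ℝ :=
  if P.lag + 1 ≤ n then I.e (n - (P.lag + 1)) ω else 0

/-- `Φ⁽¹⁾_N`: the empirical second moment of the residual, minus its expectation in the attack-free
system, where the residual is `C₁ δ_n - z_n`. -/
noncomputable def Phi₁ [MeasurableSpace Ω] (μ : Measure Ω) (P : Plant p q m) (I : Inputs Ω p q m)
    (s : Signals Ω p m) (N : ℕ) (ω : Ω) : Matrix (Fin m) (Fin m) ℝ :=
  (1 / (N : ℝ)) • ∑ n ∈ Finset.range N, vecMulVec (residual P I s n ω) (residual P I s n ω)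
    - (1 / (N : ℝ)) • ∑ n ∈ Finset.range N,
        secondMoment μ (fun ω' => P.C₁ *ᵥ nominalError P I n ω' - I.z n ω')

/-- `Φ⁽²⁾_N = (1/N) ∑_{n < N} (C₁ x̂_n - y_n) e_{n-k'-1}ᵀ`. -/
noncomputable def Phi₂ (P : Plant p q m) (I : Inputs Ω p q m) (s : Signals Ω p m)
    (N : ℕ) (ω : Ω) : Matrix (Fin m) (Fin q) ℝ :=
  (1 / (N : ℝ)) • ∑ n ∈ Finset.range N,
    vecMulVec (residual P I s n ω) (delayedExcitation P I n ω)

/-- `t_N = √((1 + ρ) S log N / N)`. -/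
noncomputable def threshold (ρ S : ℝ) (N : ℕ) : ℝ :=
  Real.sqrt ((1 + ρ) * S * Real.log N / N)

/-- The event `E_N` that the test reports an attack at time `N` (spectral norms). -/
def detection [MeasurableSpace Ω] (μ : Measure Ω) (P : Plant p q m) (I : Inputs Ω p q m)
    (s : Signals Ω p m) (ρ S : ℝ) (N : ℕ) : Set Ω :=
  {ω | threshold ρ S N < ‖Phi₁ μ P I s N ω‖} ∪ {ω | threshold ρ S N < ‖Phi₂ P I s N ω‖}

/-- The switching rule: start with the accurate sensor; use the secure sensor whenever a threshold
is violated; otherwise keep the current sensor, except that the accurate sensor is taken up again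
once the secure one has been used during the last `τ` steps. -/
structure SwitchingRule [MeasurableSpace Ω] (μ : Measure Ω) (P : Plant p q m) (I : Inputs Ω p q m)
    (s : Signals Ω p m) (ρ S : ℝ) (τ : ℕ) : Prop where
  init : ∀ ω, s.α 0 ω = 1
  violated : ∀ N ω, 1 ≤ N →
    (threshold ρ S N ≤ ‖Phi₁ μ P I s N ω‖ ∨ threshold ρ S N ≤ ‖Phi₂ P I s N ω‖) → s.α N ω = 0
  keep : ∀ N ω, 1 ≤ N →
    ‖Phi₁ μ P I s N ω‖ < threshold ρ S N → ‖Phi₂ P I s N ω‖ < threshold ρ S N →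
    ¬ (s.α (N - 1) ω = 0 ∧ τ ≤ N ∧ ∀ i ∈ Finset.Icc 1 τ, s.α (N - i) ω = 0) →
    s.α N ω = s.α (N - 1) ω
  return_ : ∀ N ω, 1 ≤ N →
    ‖Phi₁ μ P I s N ω‖ < threshold ρ S N → ‖Phi₂ P I s N ω‖ < threshold ρ S N →
    (s.α (N - 1) ω = 0 ∧ τ ≤ N ∧ ∀ i ∈ Finset.Icc 1 τ, s.α (N - i) ω = 0) →
    s.α N ω = 1

/-- The equations of the attacked loop. The input is `u_n = K x'_n + e_n`. The switching observer
sees `C(α_n) x_n + α_n z_n + (1 - α_n) η_n + α_n v_n`; the other one always sees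
`y_n = C₁ x_n + z_n + v_n`. -/
structure ClosedLoop (P : Plant p q m) (I : Inputs Ω p q m) (a : Attack Ω p m)
    (s : Signals Ω p m) : Prop where
  state : ∀ n ω, s.x (n + 1) ω =
    P.A *ᵥ s.x n ω + P.B *ᵥ (P.K *ᵥ s.x' n ω + I.e n ω) + I.w n ω
  switching_observer : ∀ n ω, s.x' (n + 1) ω =
    P.A *ᵥ s.x' n ω + P.B *ᵥ (P.K *ᵥ s.x' n ω + I.e n ω)
      + P.L (s.α n ω) *ᵥ (P.C (s.α n ω) *ᵥ s.x' n ω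
        - (P.C (s.α n ω) *ᵥ s.x n ω + (s.α n ω • I.z n ω + (1 - s.α n ω) • I.η n ω)
          + s.α n ω • s.v n ω))
  fixed_observer_init : ∀ ω, s.xh 0 ω = s.x 0 ω
  fixed_observer : ∀ n ω, s.xh (n + 1) ω =
    P.A *ᵥ s.xh n ω + P.B *ᵥ (P.K *ᵥ s.x' n ω + I.e n ω) + P.L₁ *ᵥ residual P I s n ω
  replay : ∀ n ω, s.ξ (n + 1) ω = (P.A + P.B * P.K) *ᵥ s.ξ n ω + a.d n ω
  attack : ∀ n ω, s.v n ω =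
    P.C₁ *ᵥ s.ξ n ω + a.ζ n ω - a.γ • (P.C₁ *ᵥ s.x n ω + I.z n ω)

/-- The attacker's signals and the initial conditions are measurable, the attacker's signals are
bounded, and the private excitation is independent of everything else. -/
structure PrivateExcitation [MeasurableSpace Ω] (μ : Measure Ω) (I : Inputs Ω p q m)
    (a : Attack Ω p m) (s : Signals Ω p m) : Prop where
  measurable_d : ∀ n, Measurable (a.d n)
  measurable_ζ : ∀ n, Measurable (a.ζ n)
  bounded_d : UniformlyBounded μ a.d
  bounded_ζ : UniformlyBounded μ a.ζ
  measurable_x : Measurable (s.x 0)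
  measurable_x' : Measurable (s.x' 0)
  measurable_ξ : Measurable (s.ξ 0)
  indep : IndepFun (fun ω n => I.e n ω)
    (fun ω => ((s.x 0 ω, s.x' 0 ω, s.ξ 0 ω),
      fun n => (I.w n ω, I.z n ω, I.η n ω, a.d n ω, a.ζ n ω))) μ

/-- The pairs `(d_n, ζ_n)` are bounded, centered and i.i.d. over time, and independent of the noises
of the plant. -/
structure Attack.IsWhite [MeasurableSpace Ω] (a : Attack Ω p m) (μ : Measure Ω)
    (I : Inputs Ω p q m) : Prop where
  white : IsWhiteNoise μ (fun n ω => (a.d n ω, a.ζ n ω))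
  indep : IndepFun (fun ω n => (a.d n ω, a.ζ n ω)) (fun ω n => (I.w n ω, I.z n ω, I.η n ω)) μ

/-- The attack has zero average power: `(1/N) ∑_{n < N} v_nᵀ v_n → 0` almost surely. -/
def ZeroAveragePower [MeasurableSpace Ω] (μ : Measure Ω) (v : ℕ → Ω → Fin m → ℝ) : Prop :=
  ∀ᵐ ω ∂μ, Tendsto (fun N : ℕ => (1 / (N : ℝ)) * ∑ n ∈ Finset.range N, v n ω ⬝ᵥ v n ω)
    atTop (𝓝 0)

end Tests

end Watermark

/-! Both observers are driven by the same input, so the error of the fixed observer is a stable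
linear system fed only by `w`, `z` and `v`; neither the switching signal nor the control enters it
directly. The residual is the output of this error system minus `z` and `v`. The proof splits on the
attacker's gain, and in each case shows that silence of the test at a large time is contradictory.

Nonzero gain. The attack feeds `-γ C₁ x` into the sensor, and `e_j` reaches `C₁ x` for the first
time at time `j + k' + 1`, through `H = C₁ (A + B K)^k' B`. Hence the residual at that time is `γ H
e_j + Q_j`, where `Q_j` is a function of exogenous data and of `e_0, …, e_{j-1}`
(`measurable_residual_sub`). The averages of `γ H e_j e_jᵀ` tend to `γ H Σ_E ≠ 0`. It remains to
control the martingale transform `∑ Q_j e_jᵀ`, although no bound on the switched loop, hence on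
`Q_j`, is available. The law of large numbers `tendsto_sum_mul_div_energy` is therefore
self-normalized: the transform is negligible against `1 + J + ∑ Q_j²`. If the first test is silent,
the trace of `Φ⁽¹⁾` bounds the residual power, so this normalization is of order `N`; then `Φ⁽²⁾`
stays away from zero and the second test fires.

Zero gain. The residual is a decaying transient from `ξ_0` plus the output of a stable linear system
driven by centered independent disturbances. A Lyapunov function turns its power into telescoping
terms, a martingale transform and an average of independent terms, so the empirical power follows
its mean (`tendsto_average_sq_output`). That mean is the attack-free one plus the power of the
attack's own output, which is at least the second moment of any single impulse response coefficient
(`integral_response_sq_le`). If all coefficients vanish, the attack is a free motion `C₁ (A + B K)^n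
ξ_0`, which the assumptions exclude (`exists_response_ne_zero`). So the trace of `Φ⁽¹⁾` stays above
a positive constant while the threshold tends to zero. -/

namespace Watermark

/-! ### Independent σ-algebras, filtrations and innovations. -/

section Independence

variable {Ω : Type*} {mΩ : MeasurableSpace Ω} {μ : Measure Ω}

/-- Two independent families of independent σ-algebras form one independent family. -/
theorem iIndep_sum {ι κ : Type*} {m₁ : ι → MeasurableSpace Ω} {m₂ : κ → MeasurableSpace Ω}
    (h₁ : iIndep m₁ μ) (h₂ : iIndep m₂ μ) (h : Indep (⨆ i, m₁ i) (⨆ j, m₂ j) μ) :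
    iIndep (Sum.elim m₁ m₂) μ := by
  rw [iIndep_iff]
  intro s f hf
  have e : s = s.toLeft.disjSum s.toRight := (Finset.toLeft_disjSum_toRight).symm
  have hL : ∀ i ∈ s.toLeft, MeasurableSet[m₁ i] (f (Sum.inl i)) := fun i hi =>
    hf (Sum.inl i) (by simpa using hi)
  have hR : ∀ i ∈ s.toRight, MeasurableSet[m₂ i] (f (Sum.inr i)) := fun i hi =>
    hf (Sum.inr i) (by simpa using hi)
  have hI : ⋂ i ∈ s, f i
      = (⋂ i ∈ s.toLeft, f (Sum.inl i)) ∩ ⋂ i ∈ s.toRight, f (Sum.inr i) := by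
    ext ω
    simp only [Set.mem_iInter, Set.mem_inter_iff, Finset.mem_toLeft, Finset.mem_toRight,
      Sum.forall]
  rw [hI, (Indep_iff _ _ _).1 h, h₁.meas_biInter hL, h₂.meas_biInter hR]
  · conv_rhs => rw [e]
    rw [Finset.prod_disjSum]
  · exact Finset.measurableSet_biInter _ fun i hi => le_iSup m₁ i _ (hL i hi)
  · exact Finset.measurableSet_biInter _ fun i hi => le_iSup m₂ i _ (hR i hi)

/-- The σ-algebra generated by the members of a family with index time at most `n`. -/
def past {κ : Type*} (m : κ → MeasurableSpace Ω) (hm : ∀ k, m k ≤ mΩ) (t : κ → ℕ) :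
    Filtration ℕ mΩ where
  seq n := ⨆ k ∈ {k | t k ≤ n}, m k
  mono' _ _ hij := biSup_mono fun _ (hk : _ ≤ _) => le_trans hk hij
  le' _ := iSup₂_le fun k _ => hm k

/-- The σ-algebra generated by the members of a family with index time `n + 1`. -/
abbrev innovation {κ : Type*} (m : κ → MeasurableSpace Ω) (t : κ → ℕ) (n : ℕ) : MeasurableSpace Ω :=
  ⨆ k ∈ {k | t k = n + 1}, m k

section Past

variable {κ : Type*} {m : κ → MeasurableSpace Ω} {hm : ∀ k, m k ≤ mΩ} {t : κ → ℕ}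

theorem le_past {k : κ} {n : ℕ} (h : t k ≤ n) : m k ≤ past m hm t n :=
  le_iSup₂_of_le (f := fun k (_ : k ∈ {k | t k ≤ n}) => m k) k h le_rfl

theorem le_innovation {k : κ} {n : ℕ} (h : t k = n + 1) : m k ≤ innovation m t n :=
  le_iSup₂_of_le (f := fun k (_ : k ∈ {k | t k = n + 1}) => m k) k h le_rfl

theorem innovation_le_past (n : ℕ) : innovation m t n ≤ past m hm t (n + 1) :=
  biSup_mono fun _ (hk : _ = _) => le_of_eq hk

/-- The index sets `t = n + 1` and `t ≤ n` are disjoint. Members with time `0` lie in every past and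
in no innovation, which is where data known from the start are placed. -/
theorem indep_innovation_past (h : iIndep m μ) (n : ℕ) :
    Indep (innovation m t n) (past m hm t n) μ :=
  indep_iSup_of_disjoint hm h <| Set.disjoint_left.2 fun k hk hk' => by
    simp only [Set.mem_ofPred_eq] at hk hk'
    omega

end Past

theorem indepFun_of_indep {E E' : Type*} [MeasurableSpace E] [MeasurableSpace E']
    {m₁ m₂ : MeasurableSpace Ω} (h : Indep m₁ m₂ μ) {f : Ω → E} {g : Ω → E'}
    (hf : Measurable[m₁] f) (hg : Measurable[m₂] g) : IndepFun f g μ :=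
  (IndepFun_iff_Indep _ _ _).2 (indep_of_indep_of_le h hf.comap_le hg.comap_le)

theorem integral_mul_eq_zero_of_indep {m₁ m₂ : MeasurableSpace Ω} (h : Indep m₁ m₂ μ)
    (h₁ : m₁ ≤ mΩ) (h₂ : m₂ ≤ mΩ) {f g : Ω → ℝ} (hf : Measurable[m₁] f) (hg : Measurable[m₂] g)
    (hf0 : ∫ ω, f ω ∂μ = 0) : ∫ ω, g ω * f ω ∂μ = 0 := by
  have := (indepFun_of_indep h hf hg).symm.integral_fun_mul_eq_mul_integral
    (hg.mono h₂ le_rfl).aestronglyMeasurable (hf.mono h₁ le_rfl).aestronglyMeasurable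
  rw [this, hf0, mul_zero]

end Independence

/-! ### Laws of large numbers for martingale transforms. -/

section LawOfLargeNumbers

/-- Kronecker's lemma. -/
theorem kronecker {a A : ℕ → ℝ} (hA : Monotone A) (hA1 : ∀ n, 0 < A n)
    (hAt : Tendsto A atTop atTop) {c : ℝ}
    (hc : Tendsto (fun n => ∑ k ∈ Finset.range n, a k) atTop (𝓝 c)) :
    Tendsto (fun n => (∑ k ∈ Finset.range n, A (k + 1) * a k) / A n) atTop (𝓝 0) := by
  set G : ℕ → ℝ := fun n => ∑ k ∈ Finset.range n, a k with hG
  have abel : ∀ n, ∑ k ∈ Finset.range n, A (k + 1) * a k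
      = A n * (G n - c) + A 0 * c - ∑ k ∈ Finset.range n, (A (k + 1) - A k) * (G k - c) := by
    intro n
    induction n with
    | zero => simp [hG]
    | succ n ih =>
      rw [Finset.sum_range_succ, ih, Finset.sum_range_succ]
      have : G (n + 1) = G n + a n := Finset.sum_range_succ _ _
      rw [this]; ring
  have tel : ∀ n, ∑ k ∈ Finset.range n, (A (k + 1) - A k) = A n - A 0 := fun n =>
    Finset.sum_range_sub _ _
  have hGc : Tendsto (fun n => G n - c) atTop (𝓝 0) := by
    simpa using hc.sub_const c
  -- After Abel summation the remaining sum is an average of `G k - c → 0` with nonnegative weights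
  -- of divergent total mass, hence negligible against `A n`.
  have o1 : (fun k => (A (k + 1) - A k) * (G k - c)) =o[atTop] fun k => A (k + 1) - A k := by
    have := (Asymptotics.isBigO_refl (fun k => A (k + 1) - A k) atTop).mul_isLittleO
      ((Asymptotics.isLittleO_one_iff ℝ).2 hGc)
    simpa using this
  have o2 := o1.sum_range (fun k => sub_nonneg.2 (hA (Nat.le_succ k)))
    (by simp only [tel]; exact tendsto_atTop_add_const_right _ _ hAt)
  have o3 : (fun n => ∑ k ∈ Finset.range n, (A (k + 1) - A k)) =O[atTop] A := by
    refine Asymptotics.IsBigO.of_bound 1 (Eventually.of_forall fun n => ?_)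
    rw [tel, Real.norm_of_nonneg (sub_nonneg.2 (hA (Nat.zero_le n))),
      Real.norm_of_nonneg (hA1 n).le]
    linarith [hA1 0]
  have l3 := (o2.trans_isBigO o3).tendsto_div_nhds_zero
  have l2 : Tendsto (fun n => A 0 * c / A n) atTop (𝓝 0) := tendsto_const_nhds.div_atTop hAt
  have := (hGc.add l2).sub l3
  simp only [add_zero, sub_zero] at this
  refine this.congr fun n => ?_
  rw [abel]
  have := (hA1 n).ne'
  field_simp

/-- The random normalization `1 + N + ∑_{n < N} q_n²`. -/
def energy (q : ℕ → ℝ) (N : ℕ) : ℝ := 1 + N + ∑ n ∈ Finset.range N, q n ^ 2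

theorem energy_succ (q : ℕ → ℝ) (N : ℕ) : energy q (N + 1) = energy q N + 1 + q N ^ 2 := by
  simp only [energy, Finset.sum_range_succ]; push_cast; ring

theorem one_le_energy (q : ℕ → ℝ) (N : ℕ) : 1 + (N : ℝ) ≤ energy q N :=
  le_add_of_nonneg_right (Finset.sum_nonneg fun _ _ => sq_nonneg _)

theorem energy_pos (q : ℕ → ℝ) (N : ℕ) : 0 < energy q N :=
  lt_of_lt_of_le (by positivity) (one_le_energy q N)

theorem energy_mono (q : ℕ → ℝ) : Monotone (energy q) :=
  monotone_nat_of_le_succ fun n => by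
    rw [energy_succ]; linarith [sq_nonneg (q n)]

theorem tendsto_energy (q : ℕ → ℝ) : Tendsto (energy q) atTop atTop :=
  tendsto_atTop_mono (one_le_energy q)
    (tendsto_atTop_add_const_left _ _ tendsto_natCast_atTop_atTop)

/-- Since `|q| ≤ 1 + q²`, normalized coefficients are bounded even when `q` is not integrable; this
makes the normalized transform an integrable martingale. -/
theorem abs_div_energy_le_one (q : ℕ → ℝ) (n : ℕ) : |q n / energy q (n + 1)| ≤ 1 := by
  rw [abs_div, abs_of_pos (energy_pos q _), div_le_one (energy_pos q _), energy_succ]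
  have h1 := energy_pos q n
  have h2 : |q n| ^ 2 = q n ^ 2 := sq_abs _
  nlinarith [sq_nonneg (|q n| - 1)]

/-- Each term is at most the decrement of `1 / energy`, so the sum telescopes. The bound is uniform
over all sequences, hence deterministic for random `q`. -/
theorem sum_sq_div_energy_le (q : ℕ → ℝ) (N : ℕ) :
    ∑ n ∈ Finset.range N, (q n / energy q (n + 1)) ^ 2 ≤ 1 := by
  suffices h : ∑ n ∈ Finset.range N, (q n / energy q (n + 1)) ^ 2 ≤ 1 - 1 / energy q N by
    have := energy_pos q N
    have : 0 ≤ 1 / energy q N := by positivity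
    linarith
  induction N with
  | zero => simp [energy]
  | succ n ih =>
    rw [Finset.sum_range_succ]
    have h0 := energy_pos q n
    have h1 := energy_pos q (n + 1)
    have h2 := energy_succ q n
    have h3 : (q n / energy q (n + 1)) ^ 2 ≤ 1 / energy q n - 1 / energy q (n + 1) := by
      rw [div_sub_div _ _ h0.ne' h1.ne', div_pow, div_le_div_iff₀ (by positivity) (by positivity)]
      have h4 : q n ^ 2 ≤ energy q (n + 1) - energy q n := by rw [h2]; linarith
      have h5 : energy q n ≤ energy q (n + 1) := energy_mono q (Nat.le_succ n)
      have h6 : q n ^ 2 * energy q n ≤ (energy q (n + 1) - energy q n) * energy q (n + 1) :=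
        mul_le_mul h4 h5 h0.le (sub_nonneg.2 h5)
      nlinarith
    linarith

variable {Ω : Type*} {mΩ : MeasurableSpace Ω} {μ : Measure Ω} [IsProbabilityMeasure μ]

theorem integrable_of_ae_abs_le {f : Ω → ℝ} (hf : Measurable f) {R : ℝ}
    (h : ∀ᵐ ω ∂μ, |f ω| ≤ R) : Integrable f μ :=
  Integrable.of_bound hf.aestronglyMeasurable R h

/-- The law of large numbers for martingale transforms `∑ q_n h_n` with predictable, not necessarily
bounded `q` and bounded centered innovations `h`. -/
theorem tendsto_sum_mul_div_energy (F : Filtration ℕ mΩ) {G : ℕ → MeasurableSpace Ω}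
    (hGF : ∀ n, G n ≤ F (n + 1)) (hind : ∀ n, Indep (G n) (F n) μ) {q h : ℕ → Ω → ℝ}
    (hq : ∀ n, Measurable[F n] (q n)) (hh : ∀ n, Measurable[G n] (h n)) {R : ℝ}
    (hR : ∀ n, ∀ᵐ ω ∂μ, |h n ω| ≤ R) (h0 : ∀ n, ∫ ω, h n ω ∂μ = 0) :
    ∀ᵐ ω ∂μ, Tendsto (fun N => (∑ n ∈ Finset.range N, q n ω * h n ω) /
      energy (fun n => q n ω) N) atTop (𝓝 0) := by
  have hGm : ∀ n, G n ≤ mΩ := fun n => (hGF n).trans (F.le _)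
  have hR0 : 0 ≤ R := by
    obtain ⟨ω, hω⟩ := (hR 0).exists
    exact (abs_nonneg _).trans hω
  -- The normalization at index `n + 1` involves only `q_0, …, q_n`, so `a n` is still predictable.
  -- Kronecker's lemma removes it at the end.
  set a : ℕ → Ω → ℝ := fun n ω => q n ω / energy (fun k => q k ω) (n + 1) with ha
  have haM : ∀ n, Measurable[F n] (a n) := by
    intro n
    refine (hq n).div ?_
    refine Measurable.add measurable_const ?_
    refine Finset.measurable_sum _ fun k hk => ?_
    exact ((hq k).mono (F.mono (Nat.lt_succ_iff.1 (Finset.mem_range.1 hk))) le_rfl).pow_const 2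
  have ha1 : ∀ n ω, |a n ω| ≤ 1 := fun n ω => abs_div_energy_le_one (fun k => q k ω) n
  set S : ℕ → Ω → ℝ := fun n ω => ∑ k ∈ Finset.range n, a k ω * h k ω with hS
  have hSs : ∀ n ω, S (n + 1) ω = S n ω + a n ω * h n ω := fun n ω =>
    Finset.sum_range_succ (fun k => a k ω * h k ω) n
  have hSM : ∀ n, Measurable[F n] (S n) := by
    intro n
    refine Finset.measurable_sum _ fun k hk => ?_
    have hk' := Finset.mem_range.1 hk
    exact ((haM k).mono (F.mono hk'.le) le_rfl).mul
      ((hh k).mono ((hGF k).trans (F.mono hk')) le_rfl)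
  have haM' : ∀ n, Measurable (a n) := fun n => (haM n).mono (F.le n) le_rfl
  have hhM' : ∀ n, Measurable (h n) := fun n => (hh n).mono (hGm n) le_rfl
  have hSM' : ∀ n, Measurable (S n) := fun n => (hSM n).mono (F.le n) le_rfl
  have hah : ∀ n, ∀ᵐ ω ∂μ, |a n ω * h n ω| ≤ R := fun n => by
    filter_upwards [hR n] with ω hω
    rw [abs_mul]
    calc _ ≤ 1 * R := mul_le_mul (ha1 n ω) hω (abs_nonneg _) zero_le_one
      _ = R := one_mul R
  have hSb : ∀ n, ∀ᵐ ω ∂μ, |S n ω| ≤ n * R := fun n => by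
    filter_upwards [ae_all_iff.2 hah] with ω hω
    refine (Finset.abs_sum_le_sum_abs _ _).trans ?_
    refine (Finset.sum_le_sum fun k _ => hω k).trans ?_
    simp
  have hSi : ∀ n, Integrable (S n) μ := fun n => integrable_of_ae_abs_le (hSM' n) (hSb n)
  have hmart : Martingale S F μ := by
    refine martingale_of_condExp_sub_eq_zero_nat (fun n => (hSM n).stronglyMeasurable) hSi ?_
    intro n
    have e : S (n + 1) - S n = a n * h n := by
      funext ω; simp [hSs]
    rw [e]
    have c1 := condExp_mul_of_stronglyMeasurable_left (μ := μ) (f := a n) (g := h n)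
      (haM n).stronglyMeasurable
      (integrable_of_ae_abs_le ((haM' n).mul (hhM' n)) (hah n))
      (integrable_of_ae_abs_le (hhM' n) (hR n))
    have c2 := condExp_indep_eq (hGm n) (F.le n) (hh n).stronglyMeasurable (hind n)
    filter_upwards [c1, c2] with ω w1 w2
    rw [w1, Pi.mul_apply, w2, h0 n]
    simp
  -- Martingale increments are orthogonal: the cross term has mean zero because `h n` is centered
  -- and independent of `F n`.
  have hsq : ∀ n, ∫ ω, S n ω ^ 2 ∂μ
      ≤ R ^ 2 * ∫ ω, ∑ k ∈ Finset.range n, a k ω ^ 2 ∂μ := by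
    intro n
    have ia : ∀ k, Integrable (fun ω => a k ω ^ 2) μ := fun k =>
      integrable_of_ae_abs_le (R := 1) ((haM' k).pow_const 2) (Eventually.of_forall fun ω => by
        rw [abs_pow]; exact pow_le_one₀ (abs_nonneg _) (ha1 k ω))
    induction n with
    | zero => simp [hS]
    | succ n ih =>
      have i1 : Integrable (fun ω => S n ω ^ 2) μ :=
        integrable_of_ae_abs_le (R := (n * R) ^ 2) ((hSM' n).pow_const 2) (by
          filter_upwards [hSb n] with ω hω
          rw [abs_pow]; exact pow_le_pow_left₀ (abs_nonneg _) hω 2)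
      have i2 : Integrable (fun ω => (2 * (S n ω * a n ω)) * h n ω) μ :=
        integrable_of_ae_abs_le (R := 2 * (n * R) * R)
          ((((hSM' n).mul (haM' n)).const_mul 2).mul (hhM' n)) (by
          filter_upwards [hSb n, hah n] with ω h1 h2
          have : 2 * (S n ω * a n ω) * h n ω = 2 * S n ω * (a n ω * h n ω) := by ring
          rw [this, abs_mul, abs_mul, abs_two]
          exact mul_le_mul (by linarith) h2 (abs_nonneg _) (by positivity))
      have i3 : Integrable (fun ω => (a n ω * h n ω) ^ 2) μ :=
        integrable_of_ae_abs_le (R := R ^ 2) (((haM' n).mul (hhM' n)).pow_const 2) (by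
          filter_upwards [hah n] with ω hω
          rw [abs_pow]; exact pow_le_pow_left₀ (abs_nonneg _) hω 2)
      have e : ∀ ω, S (n + 1) ω ^ 2
          = S n ω ^ 2 + (2 * (S n ω * a n ω)) * h n ω + (a n ω * h n ω) ^ 2 := fun ω => by
        rw [hSs]; ring
      simp only [e]
      have z : ∫ ω, (2 * (S n ω * a n ω)) * h n ω ∂μ = 0 :=
        integral_mul_eq_zero_of_indep (hind n) (hGm n) (F.le n) (hh n)
          (((hSM n).mul (haM n)).const_mul 2) (h0 n)
      have i12 : Integrable (fun ω => S n ω ^ 2 + (2 * (S n ω * a n ω)) * h n ω) μ := i1.add i2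
      rw [integral_add i12 i3, integral_add i1 i2, z]
      simp only [Finset.sum_range_succ]
      rw [integral_add (integrable_finsetSum _ fun k _ => ia k) (ia n), mul_add]
      have : ∫ ω, (a n ω * h n ω) ^ 2 ∂μ ≤ R ^ 2 * ∫ ω, a n ω ^ 2 ∂μ := by
        rw [← integral_const_mul]
        refine integral_mono_ae i3 ((ia n).const_mul _) ?_
        filter_upwards [hR n] with ω hω
        have : h n ω ^ 2 ≤ R ^ 2 := sq_le_sq' (abs_le.1 hω).1 (abs_le.1 hω).2
        rw [mul_pow, mul_comm]
        exact mul_le_mul_of_nonneg_right this (sq_nonneg _)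
      linarith
  -- From `|S| ≤ 1 + S²`; the `L¹` bound is what the martingale convergence theorem needs.
  have hbd : ∀ n, ∫ ω, |S n ω| ∂μ ≤ 1 + R ^ 2 := by
    intro n
    have i1 : Integrable (fun ω => S n ω ^ 2) μ :=
      integrable_of_ae_abs_le (R := (n * R) ^ 2) ((hSM' n).pow_const 2) (by
        filter_upwards [hSb n] with ω hω
        rw [abs_pow]; exact pow_le_pow_left₀ (abs_nonneg _) hω 2)
    have h1 : ∫ ω, |S n ω| ∂μ ≤ ∫ ω, (1 + S n ω ^ 2) ∂μ := by
      refine integral_mono (hSi n).abs ((integrable_const _).add i1) fun ω => ?_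
      have : |S n ω| ^ 2 = S n ω ^ 2 := sq_abs _
      simp only []
      nlinarith [sq_nonneg (|S n ω| - 1)]
    have h2 : ∫ ω, ∑ k ∈ Finset.range n, a k ω ^ 2 ∂μ ≤ 1 := by
      have : ∫ ω, ∑ k ∈ Finset.range n, a k ω ^ 2 ∂μ ≤ ∫ _, (1 : ℝ) ∂μ := by
        refine integral_mono_of_nonneg (Eventually.of_forall fun ω => ?_) (integrable_const _)
          (Eventually.of_forall fun ω => sum_sq_div_energy_le (fun k => q k ω) n)
        exact Finset.sum_nonneg fun _ _ => sq_nonneg _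
      simpa using this
    rw [integral_add (integrable_const _) i1] at h1
    have h3 := hsq n
    have h4 : R ^ 2 * ∫ ω, ∑ k ∈ Finset.range n, a k ω ^ 2 ∂μ ≤ R ^ 2 * 1 :=
      mul_le_mul_of_nonneg_left h2 (sq_nonneg _)
    simp at h1
    linarith
  have hnorm : ∀ n, eLpNorm (S n) 1 μ ≤ ((1 + R ^ 2).toNNReal : ENNReal) := by
    intro n
    rw [eLpNorm_one_eq_lintegral_enorm, ← ofReal_integral_norm_eq_lintegral_enorm (hSi n)]
    exact ENNReal.ofReal_le_ofReal (hbd n)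
  filter_upwards [hmart.submartingale.exists_ae_tendsto_of_bdd hnorm] with ω ⟨c, hc⟩
  refine (kronecker (energy_mono _) (energy_pos _) (tendsto_energy fun n => q n ω) hc).congr
    fun N => ?_
  congr 1
  refine Finset.sum_congr rfl fun k _ => ?_
  have := (energy_pos (fun n => q n ω) (k + 1)).ne'
  simp only [ha]
  field_simp

/-- The law of large numbers for martingale transforms with bounded coefficients. -/
theorem tendsto_average_mul (F : Filtration ℕ mΩ) {G : ℕ → MeasurableSpace Ω}
    (hGF : ∀ n, G n ≤ F (n + 1)) (hind : ∀ n, Indep (G n) (F n) μ) {q h : ℕ → Ω → ℝ}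
    (hq : ∀ n, Measurable[F n] (q n)) (hh : ∀ n, Measurable[G n] (h n)) {R R' : ℝ}
    (hqR : ∀ n, ∀ᵐ ω ∂μ, |q n ω| ≤ R')
    (hR : ∀ n, ∀ᵐ ω ∂μ, |h n ω| ≤ R) (h0 : ∀ n, ∫ ω, h n ω ∂μ = 0) :
    ∀ᵐ ω ∂μ, Tendsto (fun N : ℕ => (1 / (N : ℝ)) * ∑ n ∈ Finset.range N, q n ω * h n ω)
      atTop (𝓝 0) := by
  filter_upwards [tendsto_sum_mul_div_energy F hGF hind hq hh hR h0, ae_all_iff.2 hqR] with ω h1 h2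
  -- With bounded coefficients the random normalization is at most a multiple of `N`.
  have hb : ∀ᶠ N : ℕ in atTop, energy (fun n => q n ω) N * (1 / (N : ℝ)) ≤ 2 + R' ^ 2 := by
    filter_upwards [eventually_ge_atTop 1] with N hN
    have hN' : (1 : ℝ) ≤ N := by exact_mod_cast hN
    have : ∑ n ∈ Finset.range N, q n ω ^ 2 ≤ N * R' ^ 2 := by
      refine (Finset.sum_le_sum fun n _ =>
        sq_le_sq' (abs_le.1 (h2 n)).1 (abs_le.1 (h2 n)).2).trans ?_
      simp
    rw [mul_one_div, div_le_iff₀ (by linarith), energy]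
    nlinarith
  have hb' : IsBoundedUnder (· ≤ ·) atTop
      (norm ∘ fun N : ℕ => energy (fun n => q n ω) N * (1 / (N : ℝ))) :=
    isBoundedUnder_of_eventually_le (a := 2 + R' ^ 2) <| hb.mono fun N hN => by
      have := (energy_pos (fun n => q n ω) N).le
      rw [Function.comp_apply, Real.norm_of_nonneg (by positivity)]; exact hN
  refine (h1.zero_mul_isBoundedUnder_le hb').congr fun N => ?_
  have := (energy_pos (fun n => q n ω) N).ne'
  field_simp

end LawOfLargeNumbers

/-! ### Stable matrices, the Lyapunov equation and bounded linear recursions. -/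

section PowerSummable

variable {ι κ : Type*} [Fintype ι] [DecidableEq ι] [Fintype κ] [DecidableEq κ]

omit [DecidableEq κ] in
theorem norm_entry_le_l2_opNorm {𝕜 : Type*} [RCLike 𝕜] (M : Matrix κ ι 𝕜) (i : κ) (j : ι) :
    ‖M i j‖ ≤ ‖M‖ := by
  have h1 := l2_opNorm_mulVec M (EuclideanSpace.single j 1)
  have h2 := PiLp.norm_apply_le ((EuclideanSpace.equiv κ 𝕜).symm
    (M *ᵥ (EuclideanSpace.single j (1 : 𝕜)))) i
  simp at h1 h2
  exact h2.trans h1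

theorem summable_norm_of_summable_entries {M : ℕ → Matrix κ ι ℝ}
    (h : ∀ i j, Summable fun k => |M k i j|) : Summable fun k => ‖M k‖ := by
  refine Summable.of_nonneg_of_le (fun _ => norm_nonneg _) (fun k => ?_)
    (summable_sum (s := Finset.univ) fun i _ => summable_sum (s := Finset.univ) fun j _ =>
      (h i j).mul_right ‖(Matrix.single i j 1 : Matrix κ ι ℝ)‖)
  conv_lhs => rw [Matrix.matrix_eq_sum_single (M k)]
  refine (norm_sum_le _ _).trans (Finset.sum_le_sum fun i _ => ?_)
  refine (norm_sum_le _ _).trans (Finset.sum_le_sum fun j _ => ?_)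
  have : Matrix.single i j (M k i j) = M k i j • (Matrix.single i j 1 : Matrix κ ι ℝ) := by
    simp [Matrix.smul_single]
  rw [this, norm_smul, Real.norm_eq_abs]

/-- A real matrix with spectrum in the open unit disk has summable powers. -/
theorem summable_norm_pow_of_spectrum {M : Matrix ι ι ℝ}
    (h : ∀ l ∈ spectrum ℂ (M.map (algebraMap ℝ ℂ)), ‖l‖ < 1) : Summable fun k => ‖M ^ k‖ := by
  -- Over an empty index type the matrix algebra is trivial, and the spectral radius argument needs
  -- a nontrivial one.
  cases isEmpty_or_nonempty ι with
  | inl _ =>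
    have : ∀ k, ‖M ^ k‖ = 0 := fun k => by rw [Subsingleton.elim (M ^ k) 0, norm_zero]
    simp only [this]
    exact summable_zero
  | inr _ =>
    set M' := M.map (algebraMap ℝ ℂ) with hM'
    have hr : spectralRadius ℂ M' < (1 : NNReal) :=
      spectrum.spectralRadius_lt_of_forall_lt M' fun l hl => h l hl
    obtain ⟨r, hr1, hr2⟩ := ENNReal.lt_iff_exists_nnreal_btwn.1 hr
    have hr2' : r < 1 := by exact_mod_cast hr2
    -- Gelfand's formula yields geometric decay of the complexified powers; the real powers are then
    -- compared entry by entry.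
    have hlim := spectrum.pow_nnnorm_pow_one_div_tendsto_nhds_spectralRadius M'
    have hev : ∀ᶠ n : ℕ in atTop, ‖M' ^ n‖ ≤ (r : ℝ) ^ n := by
      filter_upwards [hlim.eventually_lt_const hr1, eventually_ge_atTop 1] with n hn hn1
      have hn0 : (n : ℝ) ≠ 0 := by positivity
      have h1 := ENNReal.rpow_le_rpow hn.le (Nat.cast_nonneg n : (0 : ℝ) ≤ n)
      rw [← ENNReal.rpow_mul, one_div, inv_mul_cancel₀ hn0, ENNReal.rpow_one,
        ENNReal.rpow_natCast] at h1
      exact_mod_cast h1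
    have hs : Summable fun n => ‖M' ^ n‖ := by
      refine Summable.of_norm_bounded_eventually_nat
        (summable_geometric_of_lt_one r.2 (by exact_mod_cast hr2')) ?_
      filter_upwards [hev] with n hn
      rwa [norm_norm]
    refine summable_norm_of_summable_entries fun i j => ?_
    refine Summable.of_nonneg_of_le (fun _ => abs_nonneg _) (fun n => ?_) hs
    have : M' ^ n = (M ^ n).map (algebraMap ℝ ℂ) := by
      rw [hM', Matrix.map_pow]
    have h2 := norm_entry_le_l2_opNorm (M' ^ n) i j
    rw [this, Matrix.map_apply] at h2
    rw [this]
    simpa using h2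

theorem SchurStable.summable {d : ℕ} {M : Matrix (Fin d) (Fin d) ℝ} (h : SchurStable M) :
    Summable fun k => ‖M ^ k‖ :=
  summable_norm_pow_of_spectrum h

/-- The characteristic polynomial of a block triangular matrix is the product of those of its
diagonal blocks, so the coupling block does not affect the spectrum. -/
theorem SchurStable.summable_fromBlocks {d d' : ℕ} {M : Matrix (Fin d) (Fin d) ℝ}
    {D : Matrix (Fin d') (Fin d') ℝ} (hM : SchurStable M) (hD : SchurStable D)
    (B : Matrix (Fin d) (Fin d') ℝ) : Summable fun k => ‖fromBlocks M B 0 D ^ k‖ := by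
  refine summable_norm_pow_of_spectrum fun l hl => ?_
  rw [fromBlocks_map, Matrix.map_zero _ (map_zero _), mem_spectrum_iff_isRoot_charpoly,
    charpoly_fromBlocks_zero₂₁, Polynomial.IsRoot.def, Polynomial.eval_mul, mul_eq_zero] at hl
  rcases hl with hl | hl
  · exact hM l (mem_spectrum_iff_isRoot_charpoly.2 hl)
  · exact hD l (mem_spectrum_iff_isRoot_charpoly.2 hl)

/-- The discrete Lyapunov equation. -/
theorem exists_lyapunov {M : Matrix ι ι ℝ} (h : Summable fun k => ‖M ^ k‖) (Q : Matrix ι ι ℝ) :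
    ∃ P : Matrix ι ι ℝ, P = Q + Mᵀ * P * M := by
  have hT : ∀ k, ‖Mᵀ ^ k‖ = ‖M ^ k‖ := fun k => by
    rw [← Matrix.transpose_pow, ← conjTranspose_eq_transpose_of_trivial, l2_opNorm_conjTranspose]
  have hb : ∃ c, ∀ k, ‖M ^ k‖ ≤ c := by
    obtain ⟨c, hc⟩ := h.tendsto_atTop_zero.bddAbove_range
    exact ⟨c, fun k => hc ⟨k, rfl⟩⟩
  obtain ⟨c, hc⟩ := hb
  have hs : Summable fun k => Mᵀ ^ k * Q * M ^ k := by
    refine Summable.of_norm_bounded (h.mul_left (c * ‖Q‖)) fun k => ?_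
    refine (l2_opNorm_mul _ _).trans ?_
    refine mul_le_mul_of_nonneg_right ((l2_opNorm_mul _ _).trans ?_) (norm_nonneg _)
    exact mul_le_mul_of_nonneg_right ((hT k).le.trans (hc k)) (norm_nonneg _)
  -- Splitting off the term `k = 0` of this series is the Lyapunov equation.
  refine ⟨∑' k, Mᵀ ^ k * Q * M ^ k, ?_⟩
  rw [← hs.tsum_mul_left, ← (hs.mul_left _).tsum_mul_right, hs.tsum_eq_zero_add]
  simp only [pow_zero, one_mul, mul_one]
  congr 2
  funext k
  rw [pow_succ', pow_succ]
  simp only [Matrix.mul_assoc]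

omit [DecidableEq κ] in
theorem abs_mulVec_le (M : Matrix κ ι ℝ) {v : ι → ℝ} {R : ℝ} (hv : ∀ j, |v j| ≤ R) (i : κ) :
    |(M *ᵥ v) i| ≤ ‖M‖ * (Fintype.card ι * R) := by
  rw [mulVec, dotProduct]
  refine (Finset.abs_sum_le_sum_abs _ _).trans ?_
  refine (Finset.sum_le_sum fun j _ => ?_).trans
    (b := ∑ _ : ι, ‖M‖ * R) (by simp; linarith)
  rw [abs_mul]
  exact mul_le_mul (norm_entry_le_l2_opNorm M i j) (hv j) (abs_nonneg _) (norm_nonneg _)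

omit [DecidableEq ι] in
theorem abs_dotProduct_le {u v : ι → ℝ} {R R' : ℝ} (hu : ∀ j, |u j| ≤ R) (hv : ∀ j, |v j| ≤ R') :
    |u ⬝ᵥ v| ≤ Fintype.card ι * (R * R') := by
  rw [dotProduct]
  refine (Finset.abs_sum_le_sum_abs _ _).trans ?_
  refine (Finset.sum_le_sum fun j _ => ?_).trans
    (b := ∑ _ : ι, R * R') (by simp)
  rw [abs_mul]
  exact mul_le_mul (hu j) (hv j) (abs_nonneg _) ((abs_nonneg _).trans (hu j))

/-- Variation of constants for a discrete linear recursion. -/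
theorem linear_recursion {M : Matrix ι ι ℝ} {s b : ℕ → ι → ℝ}
    (hs : ∀ n, s (n + 1) = M *ᵥ s n + b n) (n : ℕ) :
    s n = M ^ n *ᵥ s 0 + ∑ k ∈ Finset.range n, M ^ (n - 1 - k) *ᵥ b k := by
  induction n with
  | zero => simp
  | succ n ih =>
    rw [hs, ih, mulVec_add, mulVec_mulVec, ← pow_succ', Finset.sum_range_succ, add_assoc,
      Matrix.mulVec_sum]
    congr 2
    · refine Finset.sum_congr rfl fun k hk => ?_
      rw [mulVec_mulVec, ← pow_succ']
      congr 2
      have := Finset.mem_range.1 hk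
      omega
    · simp

/-- A stable linear recursion with bounded input is bounded, with an explicit bound. -/
theorem abs_linear_recursion_le {M : Matrix ι ι ℝ} (h : Summable fun k => ‖M ^ k‖)
    {s b : ℕ → ι → ℝ} (hs : ∀ n, s (n + 1) = M *ᵥ s n + b n) (h0 : s 0 = 0) {R : ℝ}
    (hR0 : 0 ≤ R) (hb : ∀ n i, |b n i| ≤ R) (n : ℕ) (i : ι) :
    |s n i| ≤ (∑' k, ‖M ^ k‖) * (Fintype.card ι * R) := by
  rw [linear_recursion hs n, h0, mulVec_zero, zero_add, Finset.sum_apply]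
  refine (Finset.abs_sum_le_sum_abs _ _).trans ?_
  refine (Finset.sum_le_sum fun k _ => abs_mulVec_le _ (hb k) i).trans ?_
  rw [← Finset.sum_mul, Finset.sum_range_reflect (fun k => ‖M ^ k‖) n]
  exact mul_le_mul_of_nonneg_right (h.sum_le_tsum _ fun _ _ => norm_nonneg _) (by positivity)

theorem tendsto_pow_mulVec {M : Matrix ι ι ℝ} (h : Summable fun k => ‖M ^ k‖) (v : ι → ℝ) :
    Tendsto (fun n => M ^ n *ᵥ v) atTop (𝓝 0) := by
  have h1 : Tendsto (fun n => M ^ n) atTop (𝓝 0) :=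
    tendsto_zero_iff_norm_tendsto_zero.2 h.tendsto_atTop_zero
  have h2 : Continuous fun N : Matrix ι ι ℝ => N *ᵥ v :=
    continuous_id.matrix_mulVec continuous_const
  have h3 := (h2.tendsto 0).comp h1
  rw [zero_mulVec] at h3
  exact h3

end PowerSummable

/-! ### Empirical power of a stable system driven by independent innovations. -/

section QuadraticLaw

variable {Ω : Type*} {mΩ : MeasurableSpace Ω} {μ : Measure Ω}
variable {ι κ : Type*} [Fintype ι] [Fintype κ]

theorem measurable_const_mulVec {m₀ : MeasurableSpace Ω} (M : Matrix κ ι ℝ) {v : Ω → ι → ℝ}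
    (hv : Measurable[m₀] v) : Measurable[m₀] fun ω => M *ᵥ v ω :=
  (continuous_const.matrix_mulVec continuous_id : Continuous fun v : ι → ℝ => M *ᵥ v).measurable.comp
    hv

theorem measurable_dotProduct {m₀ : MeasurableSpace Ω} {u v : Ω → ι → ℝ}
    (hu : Measurable[m₀] u) (hv : Measurable[m₀] v) : Measurable[m₀] fun ω => u ω ⬝ᵥ v ω :=
  Finset.measurable_sum _ fun i _ =>
    ((measurable_pi_apply i).comp hu).mul ((measurable_pi_apply i).comp hv)

omit [Fintype ι] in
theorem measurable_coord {m₀ : MeasurableSpace Ω} {v : Ω → ι → ℝ} (i : ι)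
    (hv : Measurable[m₀] v) : Measurable[m₀] fun ω => v ω i :=
  (measurable_pi_apply i).comp hv

omit [Fintype κ] in
theorem integral_mulVec_eq_zero (M : Matrix κ ι ℝ) {v : Ω → ι → ℝ}
    (hi : ∀ j, Integrable (fun ω => v ω j) μ) (h0 : ∀ j, ∫ ω, v ω j ∂μ = 0) (i : κ) :
    ∫ ω, (M *ᵥ v ω) i ∂μ = 0 := by
  simp only [mulVec, dotProduct]
  rw [integral_finsetSum _ fun j _ => (hi j).const_mul _]
  exact Finset.sum_eq_zero fun j _ => by rw [integral_const_mul, h0, mul_zero]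

variable [IsProbabilityMeasure μ] [DecidableEq ι] [DecidableEq κ]

theorem tendsto_one_div_mul_of_bounded {u : ℕ → ℝ} {R : ℝ} (h : ∀ n, |u n| ≤ R) :
    Tendsto (fun N : ℕ => (1 / (N : ℝ)) * u N) atTop (𝓝 0) :=
  tendsto_one_div_atTop_nhds_zero_nat.zero_mul_isBoundedUnder_le
    (isBoundedUnder_of ⟨R, fun n => h n⟩)

/-- The law of large numbers for the squared output of a stable linear system driven by bounded,
centered innovations. -/
theorem tendsto_average_sq_output (F : Filtration ℕ mΩ) {G : ℕ → MeasurableSpace Ω}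
    (hGF : ∀ n, G n ≤ F (n + 1)) (hind : ∀ n, Indep (G n) (F n) μ)
    {M : Matrix ι ι ℝ} (hM : Summable fun k => ‖M ^ k‖) (D : Matrix κ ι ℝ)
    {b : ℕ → Ω → ι → ℝ} {g : ℕ → Ω → κ → ℝ}
    (hb : ∀ n, Measurable[G n] (b n)) (hg : ∀ n, Measurable[G n] (g n)) {R : ℝ}
    (hbR : ∀ n, ∀ᵐ ω ∂μ, ∀ i, |b n ω i| ≤ R) (hgR : ∀ n, ∀ᵐ ω ∂μ, ∀ i, |g n ω i| ≤ R)
    (hb0 : ∀ n i, ∫ ω, b n ω i ∂μ = 0) (hg0 : ∀ n i, ∫ ω, g n ω i ∂μ = 0)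
    {s : ℕ → Ω → ι → ℝ} (hs0 : ∀ ω, s 0 ω = 0)
    (hs : ∀ n ω, s (n + 1) ω = M *ᵥ s n ω + b n ω) :
    ∀ᵐ ω ∂μ, Tendsto (fun N : ℕ => (1 / (N : ℝ)) * ∑ n ∈ Finset.range N,
      ((D *ᵥ s n ω + g n ω) ⬝ᵥ (D *ᵥ s n ω + g n ω)
        - ∫ ω', (D *ᵥ s n ω' + g n ω') ⬝ᵥ (D *ᵥ s n ω' + g n ω') ∂μ)) atTop (𝓝 0) := by
  have hGm : ∀ n, G n ≤ mΩ := fun n => (hGF n).trans (F.le _)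
  -- With empty index types the bounds on coordinates do not force `R` to be nonnegative.
  wlog hR0 : 0 ≤ R generalizing R
  · exact this (R := max R 0) (fun n => (hbR n).mono fun ω h i => (h i).trans (le_max_left _ _))
      (fun n => (hgR n).mono fun ω h i => (h i).trans (le_max_left _ _)) (le_max_right _ _)
  -- With `V = sᵀ P s`, the squared output equals the decrement of `V`, plus `s ⬝ᵥ h` with `h`
  -- linear in the innovations, plus a quadratic `r` in the innovations alone. The three parts
  -- average out by boundedness, the martingale law and independence of `r n` from the past.
  -- Symmetry of `P` is not established, whence `P + Pᵀ` in `h`.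
  obtain ⟨P, hP⟩ := exists_lyapunov hM (Dᵀ * D)
  set V : ℕ → Ω → ℝ := fun n ω => s n ω ⬝ᵥ P *ᵥ s n ω with hV
  set h : ℕ → Ω → ι → ℝ := fun n ω => (Mᵀ * (P + Pᵀ)) *ᵥ b n ω + ((2 : ℝ) • Dᵀ) *ᵥ g n ω with hh
  set r : ℕ → Ω → ℝ := fun n ω => b n ω ⬝ᵥ P *ᵥ b n ω + g n ω ⬝ᵥ g n ω with hr
  have key : ∀ n ω, (D *ᵥ s n ω + g n ω) ⬝ᵥ (D *ᵥ s n ω + g n ω)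
      = V n ω - V (n + 1) ω + s n ω ⬝ᵥ h n ω + r n ω := by
    intro n ω
    simp only [hV, hh, hr, hs]
    have e0 : s n ω ⬝ᵥ P *ᵥ s n ω = (D *ᵥ s n ω) ⬝ᵥ (D *ᵥ s n ω)
        + (M *ᵥ s n ω) ⬝ᵥ P *ᵥ (M *ᵥ s n ω) := by
      conv_lhs => rw [hP]
      rw [add_mulVec, dotProduct_add]
      simp only [← mulVec_mulVec]
      rw [dotProduct_mulVec (s n ω) Dᵀ, dotProduct_mulVec (s n ω) Mᵀ, vecMul_transpose,
        vecMul_transpose]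
    have e1 : s n ω ⬝ᵥ ((Mᵀ * (P + Pᵀ)) *ᵥ b n ω)
        = (M *ᵥ s n ω) ⬝ᵥ P *ᵥ b n ω + b n ω ⬝ᵥ P *ᵥ (M *ᵥ s n ω) := by
      rw [← mulVec_mulVec, dotProduct_mulVec (s n ω) Mᵀ, vecMul_transpose, add_mulVec,
        dotProduct_add]
      congr 1
      rw [dotProduct_mulVec, vecMul_transpose, dotProduct_comm]
    have e2 : s n ω ⬝ᵥ (((2 : ℝ) • Dᵀ) *ᵥ g n ω) = 2 * ((D *ᵥ s n ω) ⬝ᵥ g n ω) := by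
      rw [smul_mulVec, dotProduct_smul, dotProduct_mulVec, vecMul_transpose, smul_eq_mul]
    rw [dotProduct_add (s n ω), e0, e1, e2]
    simp only [mulVec_add, dotProduct_add, add_dotProduct]
    rw [dotProduct_comm (g n ω) (D *ᵥ s n ω)]
    ring
  have hsM : ∀ n, Measurable[F n] (s n) := by
    intro n
    induction n with
    | zero =>
      have : s 0 = fun _ => 0 := funext hs0
      rw [this]; exact measurable_const
    | succ n ih =>
      have : s (n + 1) = fun ω => M *ᵥ s n ω + b n ω := funext (hs n)
      rw [this]
      exact (measurable_const_mulVec M (ih.mono (F.mono (Nat.le_succ n)) le_rfl)).add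
        ((hb n).mono (hGF n) le_rfl)
  have hhM : ∀ n, Measurable[G n] (h n) := fun n =>
    (measurable_const_mulVec _ (hb n)).add (measurable_const_mulVec _ (hg n))
  have hrM : ∀ n, Measurable[G n] (r n) := fun n =>
    (measurable_dotProduct (hb n) (measurable_const_mulVec _ (hb n))).add
      (measurable_dotProduct (hg n) (hg n))
  have hVM : ∀ n, Measurable (V n) := fun n =>
    (measurable_dotProduct (hsM n) (measurable_const_mulVec _ (hsM n))).mono (F.le n) le_rfl
  obtain ⟨R₁, hsR⟩ : ∃ R₁, ∀ᵐ ω ∂μ, ∀ n i, |s n ω i| ≤ R₁ := by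
    refine ⟨(∑' k, ‖M ^ k‖) * (Fintype.card ι * R), ?_⟩
    filter_upwards [ae_all_iff.2 hbR] with ω hω n i
    exact abs_linear_recursion_le hM (s := fun n => s n ω) (b := fun n => b n ω)
      (fun n => hs n ω) (hs0 ω) hR0 hω n i
  obtain ⟨R₂, hVR⟩ : ∃ R₂, ∀ᵐ ω ∂μ, ∀ n, |V n ω| ≤ R₂ := by
    refine ⟨Fintype.card ι * (R₁ * (‖P‖ * (Fintype.card ι * R₁))), ?_⟩
    filter_upwards [hsR] with ω hω n
    exact abs_dotProduct_le (hω n) (abs_mulVec_le P (hω n))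
  obtain ⟨R₃, hhR⟩ : ∃ R₃, ∀ n, ∀ᵐ ω ∂μ, ∀ i, |h n ω i| ≤ R₃ := by
    refine ⟨‖Mᵀ * (P + Pᵀ)‖ * (Fintype.card ι * R)
      + ‖(2 : ℝ) • Dᵀ‖ * (Fintype.card κ * R), fun n => ?_⟩
    filter_upwards [hbR n, hgR n] with ω h1 h2 i
    exact (abs_add_le _ _).trans (add_le_add (abs_mulVec_le _ h1 i) (abs_mulVec_le _ h2 i))
  obtain ⟨R₄, hrR⟩ : ∃ R₄, ∀ n, ∀ᵐ ω ∂μ, |r n ω| ≤ R₄ := by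
    refine ⟨Fintype.card ι * (R * (‖P‖ * (Fintype.card ι * R)))
      + Fintype.card κ * (R * R), fun n => ?_⟩
    filter_upwards [hbR n, hgR n] with ω h1 h2
    exact (abs_add_le _ _).trans (add_le_add (abs_dotProduct_le h1 (abs_mulVec_le P h1))
      (abs_dotProduct_le h2 h2))
  have hh0 : ∀ n i, ∫ ω, h n ω i ∂μ = 0 := by
    intro n i
    have ib : ∀ j, Integrable (fun ω => b n ω j) μ := fun j =>
      integrable_of_ae_abs_le ((measurable_coord j (hb n)).mono (hGm n) le_rfl)
        ((hbR n).mono fun ω h => h j)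
    have ig : ∀ j, Integrable (fun ω => g n ω j) μ := fun j =>
      integrable_of_ae_abs_le ((measurable_coord j (hg n)).mono (hGm n) le_rfl)
        ((hgR n).mono fun ω h => h j)
    have i1 : Integrable (fun ω => ((Mᵀ * (P + Pᵀ)) *ᵥ b n ω) i) μ := by
      simp only [mulVec, dotProduct]
      exact integrable_finsetSum _ fun j _ => (ib j).const_mul _
    have i2 : Integrable (fun ω => (((2 : ℝ) • Dᵀ) *ᵥ g n ω) i) μ := by
      simp only [mulVec, dotProduct]
      exact integrable_finsetSum _ fun j _ => (ig j).const_mul _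
    simp only [hh, Pi.add_apply]
    rw [integral_add i1 i2, integral_mulVec_eq_zero _ ib (hb0 n),
      integral_mulVec_eq_zero _ ig (hg0 n), add_zero]
  have iV : ∀ n, Integrable (V n) μ := fun n =>
    integrable_of_ae_abs_le (hVM n) (hVR.mono fun ω h => h n)
  have ir : ∀ n, Integrable (r n) μ := fun n =>
    integrable_of_ae_abs_le ((hrM n).mono (hGm n) le_rfl) (hrR n)
  have ish : ∀ n i, Integrable (fun ω => s n ω i * h n ω i) μ := fun n i =>
    integrable_of_ae_abs_le (R := R₁ * R₃)
      (((measurable_coord i (hsM n)).mono (F.le n) le_rfl).mul ((measurable_coord i (hhM n)).mono (hGm n) le_rfl)) (by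
        filter_upwards [hsR, hhR n] with ω h1 h2
        rw [abs_mul]
        exact mul_le_mul (h1 n i) (h2 i) (abs_nonneg _) ((abs_nonneg _).trans (h1 n i)))
  -- The same decomposition in expectation; the martingale part has mean zero.
  have hmean : ∀ n, ∫ ω', (D *ᵥ s n ω' + g n ω') ⬝ᵥ (D *ᵥ s n ω' + g n ω') ∂μ
      = ∫ ω, V n ω ∂μ - ∫ ω, V (n + 1) ω ∂μ + ∫ ω, r n ω ∂μ := by
    intro n
    have ish' : Integrable (fun ω => s n ω ⬝ᵥ h n ω) μ := by
      simp only [dotProduct]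
      exact integrable_finsetSum _ fun i _ => ish n i
    have iVV : Integrable (fun ω => V n ω - V (n + 1) ω) μ := (iV n).sub (iV (n + 1))
    have iVs : Integrable (fun ω => V n ω - V (n + 1) ω + s n ω ⬝ᵥ h n ω) μ := iVV.add ish'
    have z : ∫ ω, s n ω ⬝ᵥ h n ω ∂μ = 0 := by
      simp only [dotProduct]
      rw [integral_finsetSum _ fun i _ => ish n i]
      exact Finset.sum_eq_zero fun i _ => integral_mul_eq_zero_of_indep (hind n) (hGm n) (F.le n)
        (measurable_coord i (hhM n)) (measurable_coord i (hsM n)) (hh0 n i)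
    simp only [key]
    rw [integral_add iVs (ir n), integral_add iVV ish', integral_sub (iV n) (iV (n + 1)), z,
      add_zero]
  have l1 : ∀ i, ∀ᵐ ω ∂μ, Tendsto (fun N : ℕ => (1 / (N : ℝ)) * ∑ n ∈ Finset.range N,
      s n ω i * h n ω i) atTop (𝓝 0) := fun i =>
    tendsto_average_mul F hGF hind (fun n => measurable_coord i (hsM n)) (fun n => measurable_coord i (hhM n))
      (fun n => hsR.mono fun ω h => h n i) (fun n => (hhR n).mono fun ω h => h i)
      (fun n => hh0 n i)
  have hR4 : ∀ n, |∫ ω, r n ω ∂μ| ≤ R₄ := fun n => by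
    have := norm_integral_le_of_norm_le_const (μ := μ) (f := r n) (hrR n)
    simpa using this
  have l2 : ∀ᵐ ω ∂μ, Tendsto (fun N : ℕ => (1 / (N : ℝ)) * ∑ n ∈ Finset.range N,
      1 * (r n ω - ∫ ω', r n ω' ∂μ)) atTop (𝓝 0) := by
    refine tendsto_average_mul F hGF hind (q := fun _ _ => 1) (R' := 1) (R := R₄ + R₄)
      (fun n => measurable_const) (fun n => (hrM n).sub measurable_const)
      (fun n => Eventually.of_forall fun _ => by simp) (fun n => ?_) fun n => ?_
    · filter_upwards [hrR n] with ω hω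
      exact (abs_sub _ _).trans (add_le_add hω (hR4 n))
    · rw [integral_sub (ir n) (integrable_const _)]
      simp
  filter_upwards [ae_all_iff.2 l1, l2, hVR] with ω h1 h2 h3
  have l3 : Tendsto (fun N : ℕ => (1 / (N : ℝ)) *
      ((V 0 ω - ∫ ω', V 0 ω' ∂μ) - (V N ω - ∫ ω', V N ω' ∂μ))) atTop (𝓝 0) := by
    have hE : ∀ n, |∫ ω', V n ω' ∂μ| ≤ R₂ := fun n => by
      have := norm_integral_le_of_norm_le_const (μ := μ) (f := V n) (hVR.mono fun ω h => h n)
      simpa using this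
    refine tendsto_one_div_mul_of_bounded (u := fun N => (V 0 ω - ∫ ω', V 0 ω' ∂μ)
      - (V N ω - ∫ ω', V N ω' ∂μ)) (R := (R₂ + R₂) + (R₂ + R₂)) fun n => ?_
    exact (abs_sub _ _).trans (add_le_add ((abs_sub _ _).trans (add_le_add (h3 0) (hE 0)))
      ((abs_sub _ _).trans (add_le_add (h3 n) (hE n))))
  have l4 := (l3.add (tendsto_finsetSum (Finset.univ : Finset ι) fun i _ => h1 i)).add h2
  simp only [Finset.sum_const_zero, add_zero] at l4
  refine l4.congr fun N => ?_
  rw [← Finset.mul_sum, Finset.sum_comm, ← mul_add, ← mul_add]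
  congr 1
  rw [← Finset.sum_range_sub' (fun n => V n ω - ∫ ω', V n ω' ∂μ) N, ← Finset.sum_add_distrib,
    ← Finset.sum_add_distrib]
  refine Finset.sum_congr rfl fun n _ => ?_
  rw [key, hmean, dotProduct]
  ring

end QuadraticLaw

/-! ### Spectral norm and threshold. -/

theorem measurable_l2_opNorm {Ω : Type*} {m₀ : MeasurableSpace Ω} {a b : ℕ}
    {M : Ω → Matrix (Fin a) (Fin b) ℝ} (h : ∀ i j, Measurable[m₀] fun ω => M ω i j) :
    Measurable[m₀] fun ω => ‖M ω‖ := by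
  have hc : Continuous fun f : Fin a → Fin b → ℝ => ‖(Matrix.of f : Matrix (Fin a) (Fin b) ℝ)‖ :=
    continuous_norm.comp continuous_id
  exact hc.measurable.comp (measurable_pi_lambda _ fun i => measurable_pi_lambda _ (h i))

/-- This is all that is needed about the size of the threshold: any statistic that stays away from
zero eventually exceeds it. -/
theorem tendsto_threshold (ρ S : ℝ) : Tendsto (threshold ρ S) atTop (𝓝 0) := by
  have h1 : Tendsto (fun N : ℕ => Real.log N / N) atTop (𝓝 0) :=
    (Real.isLittleO_log_id_atTop.tendsto_div_nhds_zero).comp tendsto_natCast_atTop_atTop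
  have h2 := (h1.const_mul ((1 + ρ) * S)).sqrt
  simp only [mul_zero, Real.sqrt_zero] at h2
  refine h2.congr fun N => ?_
  rw [threshold, mul_div_assoc]

/-! ### Residual, error dynamics and causality of the loop. -/

section Residual

variable {Ω : Type*} {p q m : ℕ} {P : Plant p q m} {I : Inputs Ω p q m} {a : Attack Ω p m}
  {s : Signals Ω p m}

theorem abs_trace_le (M : Matrix (Fin m) (Fin m) ℝ) : |M.trace| ≤ m * ‖M‖ := by
  rw [Matrix.trace]
  refine (Finset.abs_sum_le_sum_abs _ _).trans ?_
  refine (Finset.sum_le_sum fun i _ => norm_entry_le_l2_opNorm M i i).trans ?_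
  simp

/-- The trace reduces the first test to scalar power; with `abs_trace_le`, a small norm bounds the
residual power and a large trace forces a large norm. -/
theorem trace_Phi₁ [MeasurableSpace Ω] (μ : Measure Ω) (N : ℕ) (ω : Ω) :
    (Phi₁ μ P I s N ω).trace
      = (1 / (N : ℝ)) * ∑ n ∈ Finset.range N, residual P I s n ω ⬝ᵥ residual P I s n ω
        - (1 / (N : ℝ)) * ∑ n ∈ Finset.range N,
          (secondMoment μ fun ω' => P.C₁ *ᵥ nominalError P I n ω' - I.z n ω').trace := by
  simp only [Phi₁, Matrix.trace_sub, Matrix.trace_smul, Matrix.trace_sum, smul_eq_mul,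
    Matrix.trace_vecMulVec]

/-- The estimation error `x̂ - x` of the never switching observer. -/
def estimationError (s : Signals Ω p m) (n : ℕ) (ω : Ω) : Fin p → ℝ := s.xh n ω - s.x n ω

theorem residual_eq (n : ℕ) (ω : Ω) :
    residual P I s n ω = P.C₁ *ᵥ estimationError s n ω - I.z n ω - s.v n ω := by
  simp only [residual, measurement, estimationError, mulVec_sub]
  abel

theorem ClosedLoop.estimationError_zero (h : ClosedLoop P I a s) (ω : Ω) :
    estimationError s 0 ω = 0 := by
  simp [estimationError, h.fixed_observer_init]

/-- The common input `B (K x' + e)` cancels in the difference, so switching and excitation can act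
on the error only through the attack `v`. -/
theorem ClosedLoop.estimationError_succ (h : ClosedLoop P I a s) (n : ℕ) (ω : Ω) :
    estimationError s (n + 1) ω = (P.A + P.L₁ * P.C₁) *ᵥ estimationError s n ω
      - I.w n ω - P.L₁ *ᵥ (I.z n ω + s.v n ω) := by
  have e : estimationError s (n + 1) ω = P.A *ᵥ estimationError s n ω - I.w n ω
      + P.L₁ *ᵥ residual P I s n ω := by
    simp only [estimationError, h.fixed_observer, h.state, mulVec_sub]
    abel
  rw [e, residual_eq]
  simp only [add_mulVec, mulVec_sub, mulVec_add, ← mulVec_mulVec]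
  abel

theorem ClosedLoop.state_eq (h : ClosedLoop P I a s) (n : ℕ) (ω : Ω) :
    s.x (n + 1) ω = (P.A + P.B * P.K) *ᵥ s.x n ω + P.B *ᵥ (P.K *ᵥ (s.x' n ω - s.x n ω))
      + P.B *ᵥ I.e n ω + I.w n ω := by
  rw [h.state]
  simp only [add_mulVec, mulVec_sub, mulVec_add, ← mulVec_mulVec]
  abel

theorem Plant.lag_spec (h : ∃ k : ℕ, P.C₁ * (P.A + P.B * P.K) ^ k * P.B ≠ 0) :
    P.C₁ * (P.A + P.B * P.K) ^ P.lag * P.B ≠ 0 :=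
  Nat.sInf_mem (s := {k : ℕ | P.C₁ * (P.A + P.B * P.K) ^ k * P.B ≠ 0}) h

theorem Plant.eq_zero_of_lt_lag {k : ℕ} (h : k < P.lag) :
    P.C₁ * (P.A + P.B * P.K) ^ k * P.B = 0 :=
  not_not.1 (Nat.notMem_of_lt_sInf h)

/-- Initial conditions and all random inputs other than the private excitation. -/
def exogenous (I : Inputs Ω p q m) (a : Attack Ω p m) (s : Signals Ω p m) (ω : Ω) :
    ((Fin p → ℝ) × (Fin p → ℝ) × (Fin p → ℝ)) ×
      (ℕ → (Fin p → ℝ) × (Fin m → ℝ) × (Fin m → ℝ) × (Fin p → ℝ) × (Fin m → ℝ)) :=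
  ((s.x 0 ω, s.x' 0 ω, s.ξ 0 ω), fun n => (I.w n ω, I.z n ω, I.η n ω, a.d n ω, a.ζ n ω))

section Measurability

variable {𝓖 : MeasurableSpace Ω}

theorem measurable_inputs (h : Measurable[𝓖] (exogenous I a s)) (n : ℕ) :
    Measurable[𝓖] (I.w n) ∧ Measurable[𝓖] (I.z n) ∧ Measurable[𝓖] (I.η n)
      ∧ Measurable[𝓖] (a.d n) ∧ Measurable[𝓖] (a.ζ n) := by
  have h' : Measurable[𝓖] fun ω => (I.w n ω, I.z n ω, I.η n ω, a.d n ω, a.ζ n ω) :=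
    (measurable_pi_apply n).comp h.snd
  exact ⟨h'.fst, h'.snd.fst, h'.snd.snd.fst, h'.snd.snd.snd.fst, h'.snd.snd.snd.snd⟩

theorem measurable_ξ (hloop : ClosedLoop P I a s) (h : Measurable[𝓖] (exogenous I a s)) (n : ℕ) :
    Measurable[𝓖] (s.ξ n) := by
  induction n with
  | zero => exact h.fst.snd.snd
  | succ n ih =>
    rw [funext (hloop.replay n)]
    exact (measurable_const_mulVec _ ih).add (measurable_inputs h n).2.2.2.1

/-- Only `C₁ x` is assumed measurable, not `x`: up to the lag, the output is free of the latest
excitation while the state is not. -/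
theorem measurable_v (hloop : ClosedLoop P I a s) (h : Measurable[𝓖] (exogenous I a s)) {n : ℕ}
    (hx : Measurable[𝓖] fun ω => P.C₁ *ᵥ s.x n ω) : Measurable[𝓖] (s.v n) := by
  rw [funext (hloop.attack n)]
  obtain ⟨_, hz, _, _, hζ⟩ := measurable_inputs h n
  exact ((measurable_const_mulVec _ (measurable_ξ hloop h n)).add hζ).sub
    ((hx.add hz).const_smul a.γ)

theorem measurable_residual (hloop : ClosedLoop P I a s) (h : Measurable[𝓖] (exogenous I a s))
    {n : ℕ} (hx : Measurable[𝓖] (s.x n)) (hxh : Measurable[𝓖] (s.xh n)) :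
    Measurable[𝓖] (residual P I s n) :=
  (measurable_const_mulVec _ hxh).sub
    (((measurable_const_mulVec _ hx).add (measurable_inputs h n).2.1).add
      (measurable_v hloop h (measurable_const_mulVec _ hx)))

theorem measurable_norm_Phi₁ [mΩ : MeasurableSpace Ω] (μ : Measure Ω) {N : ℕ}
    (h : ∀ n < N, Measurable[𝓖] (residual P I s n)) :
    Measurable[𝓖] fun ω => ‖Phi₁ μ P I s N ω‖ := by
  refine measurable_l2_opNorm fun i j => ?_
  simp only [Phi₁, Matrix.sub_apply, Matrix.smul_apply, Matrix.sum_apply, vecMulVec_apply, smul_eq_mul]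
  refine Measurable.sub (Measurable.const_mul (Finset.measurable_sum _ fun n hn => ?_) _)
    measurable_const
  have := h n (Finset.mem_range.1 hn)
  exact (measurable_coord i this).mul (measurable_coord j this)

theorem measurable_norm_Phi₂ {N : ℕ} (h : ∀ n < N, Measurable[𝓖] (residual P I s n))
    (he : ∀ n < N, Measurable[𝓖] (I.e n)) :
    Measurable[𝓖] fun ω => ‖Phi₂ P I s N ω‖ := by
  refine measurable_l2_opNorm fun i j => ?_
  simp only [Phi₂, Matrix.smul_apply, Matrix.sum_apply, vecMulVec_apply, smul_eq_mul]
  refine Measurable.const_mul (Finset.measurable_sum _ fun n hn => ?_) _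
  have hn := Finset.mem_range.1 hn
  refine (measurable_coord i (h n hn)).mul (measurable_coord j ?_)
  unfold delayedExcitation
  split_ifs
  · exact he _ (by omega)
  · exact measurable_const

theorem measurable_matrix_mulVec {a b : ℕ} {M : Ω → Matrix (Fin a) (Fin b) ℝ} {v : Ω → Fin b → ℝ}
    (hM : ∀ i j, Measurable[𝓖] fun ω => M ω i j) (hv : Measurable[𝓖] v) :
    Measurable[𝓖] fun ω => M ω *ᵥ v ω :=
  measurable_pi_lambda _ fun i => by
    simp only [mulVec, dotProduct]
    exact Finset.measurable_sum _ fun j _ => (hM i j).mul (measurable_coord j hv)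

open Classical in
theorem SwitchingRule.α_succ [mΩ : MeasurableSpace Ω] {μ : Measure Ω} {ρ S : ℝ} {τ : ℕ}
    (h : SwitchingRule μ P I s ρ S τ) (n : ℕ) (ω : Ω) : s.α (n + 1) ω =
      if threshold ρ S (n + 1) ≤ ‖Phi₁ μ P I s (n + 1) ω‖ ∨
          threshold ρ S (n + 1) ≤ ‖Phi₂ P I s (n + 1) ω‖ then 0
      else if s.α n ω = 0 ∧ τ ≤ n + 1 ∧ ∀ i ∈ Finset.Icc 1 τ, s.α (n + 1 - i) ω = 0 then 1
      else s.α n ω := by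
  split_ifs with h1 h2
  · exact h.violated _ _ (by omega) h1
  · push Not at h1
    exact h.return_ _ _ (by omega) h1.1 h1.2 h2
  · push Not at h1
    exact h.keep _ _ (by omega) h1.1 h1.2 h2

/-- Causality of the loop: `e_n` acts only after time `n`, and `Φ_N` uses only residuals before `N`,
so the switching decision at `N` does not look ahead. The induction is strong because that decision
depends on the whole history. -/
theorem measurable_signals [mΩ : MeasurableSpace Ω] {μ : Measure Ω} {ρ S : ℝ} {τ : ℕ}
    (hloop : ClosedLoop P I a s) (hswitch : SwitchingRule μ P I s ρ S τ) {N : ℕ}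
    (h : Measurable[𝓖] (exogenous I a s)) (he : ∀ n < N, Measurable[𝓖] (I.e n)) :
    ∀ n ≤ N, Measurable[𝓖] (s.x n) ∧ Measurable[𝓖] (s.x' n) ∧ Measurable[𝓖] (s.xh n)
      ∧ Measurable[𝓖] (s.α n) := by
  intro n
  induction n using Nat.strong_induction_on with
  | _ n ih =>
  intro hn
  cases n with
  | zero =>
    refine ⟨h.fst.fst, h.fst.snd.fst, ?_, ?_⟩
    · rw [funext hloop.fixed_observer_init]; exact h.fst.fst
    · rw [funext hswitch.init]; exact measurable_const
  | succ n =>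
    obtain ⟨hx, hx', hxh, hα⟩ := ih n (by omega) (by omega)
    obtain ⟨hw, hz, hη, hd, hζ⟩ := measurable_inputs h n
    have hen := he n (by omega)
    have hv := measurable_v hloop h (measurable_const_mulVec P.C₁ hx)
    have hres : ∀ k < n + 1, Measurable[𝓖] (residual P I s k) := fun k hk =>
      measurable_residual hloop h (ih k hk (by omega)).1 (ih k hk (by omega)).2.2.1
    have hu : Measurable[𝓖] fun ω => P.B *ᵥ (P.K *ᵥ s.x' n ω + I.e n ω) :=
      measurable_const_mulVec _ ((measurable_const_mulVec _ hx').add hen)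
    have hC : ∀ i j, Measurable[𝓖] fun ω => P.C (s.α n ω) i j := fun i j => by
      simp only [Plant.C, Matrix.add_apply, Matrix.smul_apply, smul_eq_mul]
      exact (hα.mul_const _).add ((measurable_const.sub hα).mul_const _)
    have hL : ∀ i j, Measurable[𝓖] fun ω => P.L (s.α n ω) i j := fun i j => by
      simp only [Plant.L, Matrix.add_apply, Matrix.smul_apply, smul_eq_mul]
      exact (hα.mul_const _).add ((measurable_const.sub hα).mul_const _)
    refine ⟨?_, ?_, ?_, ?_⟩
    · rw [funext (hloop.state n)]
      exact ((measurable_const_mulVec _ hx).add hu).add hw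
    · rw [funext (hloop.switching_observer n)]
      refine ((measurable_const_mulVec _ hx').add hu).add (measurable_matrix_mulVec hL ?_)
      refine (measurable_matrix_mulVec hC hx').sub
        (((measurable_matrix_mulVec hC hx).add ?_).add (hα.smul hv))
      exact (hα.smul hz).add ((measurable_const.sub hα).smul hη)
    · rw [funext (hloop.fixed_observer n)]
      exact ((measurable_const_mulVec _ hxh).add hu).add
        (measurable_const_mulVec _ (hres n (by omega)))
    · classical
      rw [funext (hswitch.α_succ n)]
      have hαs : ∀ k < n + 1, MeasurableSet[𝓖] {ω | s.α k ω = 0} := fun k hk =>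
        (ih k hk (by omega)).2.2.2 (measurableSet_singleton 0)
      refine Measurable.ite (MeasurableSet.union ?_ ?_) measurable_const
        (Measurable.ite ((hαs n (by omega)).inter (MeasurableSet.inter ?_ ?_)) measurable_const hα)
      · exact measurableSet_le measurable_const (measurable_norm_Phi₁ μ hres)
      · exact measurableSet_le measurable_const
          (measurable_norm_Phi₂ hres fun k hk => he k (by omega))
      · exact MeasurableSet.const _
      · have : {ω | ∀ i ∈ Finset.Icc 1 τ, s.α (n + 1 - i) ω = 0}
            = ⋂ i ∈ Finset.Icc 1 τ, {ω | s.α (n + 1 - i) ω = 0} := by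
          ext; simp
        have h2 : MeasurableSet[𝓖] {ω | ∀ i ∈ Finset.Icc 1 τ, s.α (n + 1 - i) ω = 0} := by
          rw [this]
          exact Finset.measurableSet_biInter _ fun i hi => hαs _ (by
            have := (Finset.mem_Icc.1 hi).1; omega)
        exact h2

end Measurability

end Residual

/-! ### Propagation of the excitation to the residual, and nonzero gain. -/

section Feedback

variable {Ω : Type*} {p q m : ℕ} {P : Plant p q m} {I : Inputs Ω p q m} {a : Attack Ω p m}
  {s : Signals Ω p m}

/-- For `l` below the lag both terms with factor `B` vanish, removing not only `e_n` but also the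
feedback error `x' - x`, the only way in which the switching enters the state equation. -/
theorem ClosedLoop.obs_succ (h : ClosedLoop P I a s) (l n : ℕ) (ω : Ω) :
    (P.C₁ * (P.A + P.B * P.K) ^ l) *ᵥ s.x (n + 1) ω
      = (P.C₁ * (P.A + P.B * P.K) ^ (l + 1)) *ᵥ s.x n ω
        + (P.C₁ * (P.A + P.B * P.K) ^ l * P.B) *ᵥ (P.K *ᵥ (s.x' n ω - s.x n ω))
        + (P.C₁ * (P.A + P.B * P.K) ^ l * P.B) *ᵥ I.e n ω
        + (P.C₁ * (P.A + P.B * P.K) ^ l) *ᵥ I.w n ω := by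
  rw [h.state_eq, pow_succ, ← Matrix.mul_assoc]
  simp only [mulVec_add, mulVec_mulVec, Matrix.mul_assoc]

section Measurability

variable {𝓖 : MeasurableSpace Ω} [mΩ : MeasurableSpace Ω] {μ : Measure Ω} {ρ S : ℝ} {τ : ℕ}

/-- Going back one step raises the power of `A + B K` by one. All exponents next to `B` stay below
the lag, so the recursion reaches `x_j` without meeting any excitation from time `j` on. -/
theorem measurable_obs (hloop : ClosedLoop P I a s) (hswitch : SwitchingRule μ P I s ρ S τ) {j : ℕ}
    (h : Measurable[𝓖] (exogenous I a s)) (he : ∀ n < j, Measurable[𝓖] (I.e n)) (i l : ℕ)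
    (hil : l + i ≤ P.lag) :
    Measurable[𝓖] fun ω => (P.C₁ * (P.A + P.B * P.K) ^ l) *ᵥ s.x (j + i) ω := by
  induction i generalizing l with
  | zero => exact measurable_const_mulVec _ (measurable_signals hloop hswitch h he j le_rfl).1
  | succ i ih =>
    have e : (fun ω => (P.C₁ * (P.A + P.B * P.K) ^ l) *ᵥ s.x (j + (i + 1)) ω) = fun ω =>
        (P.C₁ * (P.A + P.B * P.K) ^ (l + 1)) *ᵥ s.x (j + i) ω
          + (P.C₁ * (P.A + P.B * P.K) ^ l) *ᵥ I.w (j + i) ω := by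
      funext ω
      rw [← add_assoc, hloop.obs_succ, Plant.eq_zero_of_lt_lag (by omega)]
      simp
    rw [e]
    exact (ih (l + 1) (by omega)).add (measurable_const_mulVec _ (measurable_inputs h _).1)

/-- With one more time step the exponent reaches the lag exactly at time `j`, where the single term
`H e_j` appears. -/
theorem measurable_obs_sub (hloop : ClosedLoop P I a s) (hswitch : SwitchingRule μ P I s ρ S τ)
    {j : ℕ} (h : Measurable[𝓖] (exogenous I a s)) (he : ∀ n < j, Measurable[𝓖] (I.e n)) (i l : ℕ)
    (hil : l + i = P.lag) :
    Measurable[𝓖] fun ω => (P.C₁ * (P.A + P.B * P.K) ^ l) *ᵥ s.x (j + i + 1) ω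
      - (P.C₁ * (P.A + P.B * P.K) ^ P.lag * P.B) *ᵥ I.e j ω := by
  induction i generalizing l with
  | zero =>
    obtain rfl : l = P.lag := by omega
    obtain ⟨hx, hx', _⟩ := measurable_signals hloop hswitch h he j le_rfl
    have e : (fun ω => (P.C₁ * (P.A + P.B * P.K) ^ P.lag) *ᵥ s.x (j + 0 + 1) ω
        - (P.C₁ * (P.A + P.B * P.K) ^ P.lag * P.B) *ᵥ I.e j ω) = fun ω =>
        (P.C₁ * (P.A + P.B * P.K) ^ (P.lag + 1)) *ᵥ s.x j ω
          + (P.C₁ * (P.A + P.B * P.K) ^ P.lag * P.B) *ᵥ (P.K *ᵥ (s.x' j ω - s.x j ω))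
          + (P.C₁ * (P.A + P.B * P.K) ^ P.lag) *ᵥ I.w j ω := by
      funext ω
      rw [add_zero, hloop.obs_succ]
      abel
    rw [e]
    exact ((measurable_const_mulVec _ hx).add (measurable_const_mulVec _
      (measurable_const_mulVec _ (hx'.sub hx)))).add
        (measurable_const_mulVec _ (measurable_inputs h _).1)
  | succ i ih =>
    have e : (fun ω => (P.C₁ * (P.A + P.B * P.K) ^ l) *ᵥ s.x (j + (i + 1) + 1) ω
        - (P.C₁ * (P.A + P.B * P.K) ^ P.lag * P.B) *ᵥ I.e j ω) = fun ω =>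
        ((P.C₁ * (P.A + P.B * P.K) ^ (l + 1)) *ᵥ s.x (j + i + 1) ω
          - (P.C₁ * (P.A + P.B * P.K) ^ P.lag * P.B) *ᵥ I.e j ω)
          + (P.C₁ * (P.A + P.B * P.K) ^ l) *ᵥ I.w (j + i + 1) ω := by
      funext ω
      rw [← add_assoc, hloop.obs_succ, Plant.eq_zero_of_lt_lag (k := l) (by omega)]
      simp only [zero_mulVec, add_zero]
      abel
    rw [e]
    exact (ih (l + 1) (by omega)).add (measurable_const_mulVec _ (measurable_inputs h _).1)

/-- The residual minus the feedthrough of the private excitation with the smallest delay depends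
only on earlier excitation. -/
theorem measurable_residual_sub (hloop : ClosedLoop P I a s)
    (hswitch : SwitchingRule μ P I s ρ S τ) {j : ℕ} (h : Measurable[𝓖] (exogenous I a s))
    (he : ∀ n < j, Measurable[𝓖] (I.e n)) :
    Measurable[𝓖] fun ω => residual P I s (j + (P.lag + 1)) ω
      - a.γ • ((P.C₁ * (P.A + P.B * P.K) ^ P.lag * P.B) *ᵥ I.e j ω) := by
  have hCx : ∀ n ≤ j + P.lag, Measurable[𝓖] fun ω => P.C₁ *ᵥ s.x n ω := by
    intro n hn
    rcases le_total n j with hnj | hnj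
    · exact measurable_const_mulVec _ (measurable_signals hloop hswitch h he n hnj).1
    · obtain ⟨i, rfl⟩ := Nat.exists_eq_add_of_le hnj
      simpa using measurable_obs hloop hswitch h he i 0 (by omega)
  -- The error at `n + 1` uses `v` only up to `n`, so it is free of `e_j` one step longer than the
  -- output. At `j + P.lag + 1` the excitation `e_j` therefore enters the residual only through
  -- `-v`, giving `+γ H e_j`.
  have hδ : ∀ n ≤ j + P.lag + 1, Measurable[𝓖] (estimationError s n) := by
    intro n
    induction n with
    | zero => intro _; rw [funext hloop.estimationError_zero]; exact measurable_const
    | succ n ih =>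
      intro hn
      rw [funext (hloop.estimationError_succ n)]
      obtain ⟨hw, hz, _⟩ := measurable_inputs h n
      exact ((measurable_const_mulVec _ (ih (by omega))).sub hw).sub
        (measurable_const_mulVec _ (hz.add (measurable_v hloop h (hCx n (by omega)))))
  have hx := measurable_obs_sub hloop hswitch h he P.lag 0 (by omega)
  simp only [pow_zero, Matrix.mul_one] at hx
  set n := j + P.lag + 1 with hn
  have hn' : j + (P.lag + 1) = n := by omega
  obtain ⟨_, hz, _, _, hζ⟩ := measurable_inputs h n
  have e : (fun ω => residual P I s (j + (P.lag + 1)) ω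
      - a.γ • ((P.C₁ * (P.A + P.B * P.K) ^ P.lag * P.B) *ᵥ I.e j ω)) = fun ω =>
      P.C₁ *ᵥ estimationError s n ω - I.z n ω - (P.C₁ *ᵥ s.ξ n ω + a.ζ n ω)
        + a.γ • ((P.C₁ *ᵥ s.x n ω
          - (P.C₁ * (P.A + P.B * P.K) ^ P.lag * P.B) *ᵥ I.e j ω) + I.z n ω) := by
    funext ω
    rw [hn', residual_eq, hloop.attack]
    simp only [smul_add, smul_sub]
    abel
  rw [e]
  exact (((measurable_const_mulVec _ (hδ n le_rfl)).sub hz).sub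
    ((measurable_const_mulVec _ (measurable_ξ hloop h n)).add hζ)).add ((hx.add hz).const_smul a.γ)

end Measurability

theorem Phi₂_apply (ω : Ω) (J : ℕ) (i : Fin m) (k : Fin q) :
    Phi₂ P I s (P.lag + 1 + J) ω i k = (1 / ((P.lag + 1 + J : ℕ) : ℝ)) *
      ∑ j ∈ Finset.range J, residual P I s (j + (P.lag + 1)) ω i * I.e j ω k := by
  simp only [Phi₂, Matrix.smul_apply, Matrix.sum_apply, vecMulVec_apply, smul_eq_mul]
  rw [Finset.sum_range_add]
  have h0 : ∑ n ∈ Finset.range (P.lag + 1), residual P I s n ω i * delayedExcitation P I n ω k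
      = 0 := Finset.sum_eq_zero fun n hn => by
    have := Finset.mem_range.1 hn
    rw [delayedExcitation, if_neg (by omega)]
    simp
  rw [h0, zero_add]
  congr 1
  refine Finset.sum_congr rfl fun j _ => ?_
  rw [delayedExcitation, if_pos (by omega), add_comm (P.lag + 1) j, Nat.add_sub_cancel]

variable [mΩ : MeasurableSpace Ω] {μ : Measure Ω} [IsProbabilityMeasure μ]

omit [IsProbabilityMeasure μ] in
theorem UniformlyBounded.exists_coord_bound {ι : Type*} [Fintype ι] {f : ℕ → Ω → ι → ℝ}
    (h : UniformlyBounded μ f) : ∃ R, 0 ≤ R ∧ ∀ᵐ ω ∂μ, ∀ n i, |f n ω i| ≤ R := by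
  obtain ⟨R, hR⟩ := h
  refine ⟨max R 0, le_max_right _ _, ?_⟩
  filter_upwards [ae_all_iff.2 hR] with ω hω n i
  exact (norm_le_pi_norm (f n ω) i).trans ((hω n).trans (le_max_left _ _))

theorem IsWhiteNoise.integrable_coord {ι : Type*} [Fintype ι] {f : ℕ → Ω → ι → ℝ}
    (h : IsWhiteNoise μ f) (n : ℕ) : Integrable (f n) μ := by
  obtain ⟨R, hR⟩ := h.bounded
  exact Integrable.of_bound (h.measurable n).aestronglyMeasurable R (hR n)

theorem IsWhiteNoise.mean_coord {ι : Type*} [Fintype ι] {f : ℕ → Ω → ι → ℝ}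
    (h : IsWhiteNoise μ f) (n : ℕ) (i : ι) : ∫ ω, f n ω i ∂μ = 0 := by
  rw [← eval_integral fun i => (h.integrable_coord n).eval i, h.mean_zero n, Pi.zero_apply]

/-- The attack-free residual. -/
def nominalResidual (P : Plant p q m) (I : Inputs Ω p q m) (n : ℕ) (ω : Ω) : Fin m → ℝ :=
  P.C₁ *ᵥ nominalError P I n ω - I.z n ω

omit mΩ in
theorem nominalError_succ (n : ℕ) (ω : Ω) : nominalError P I (n + 1) ω
    = (P.A + P.L₁ * P.C₁) *ᵥ nominalError P I n ω + (-I.w n ω - P.L₁ *ᵥ I.z n ω) := by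
  rw [nominalError]; abel

omit [IsProbabilityMeasure μ] in
theorem exists_nominalResidual_bound (hP : P.Stable) (hI : I.Admissible μ) :
    ∃ R, ∀ᵐ ω ∂μ, ∀ n i, |nominalResidual P I n ω i| ≤ R := by
  obtain ⟨R₁, h10, h1⟩ := hI.process.bounded.exists_coord_bound
  obtain ⟨R₂, h20, h2⟩ := hI.measurement₁.bounded.exists_coord_bound
  set R₃ := R₁ + ‖P.L₁‖ * (Fintype.card (Fin m) * R₂) with hR3
  have h30 : 0 ≤ R₃ := by positivity
  refine ⟨‖P.C₁‖ * (Fintype.card (Fin p) * ((∑' k, ‖(P.A + P.L₁ * P.C₁) ^ k‖)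
    * (Fintype.card (Fin p) * R₃))) + R₂, ?_⟩
  filter_upwards [h1, h2] with ω w1 w2 n i
  refine (abs_sub _ _).trans (add_le_add (abs_mulVec_le _ (fun j => ?_) i) (w2 n i))
  refine abs_linear_recursion_le hP.observer₁.summable (s := fun n => nominalError P I n ω)
    (fun n => nominalError_succ n ω) rfl h30 (fun n i => ?_) n j
  refine (abs_sub _ _).trans (add_le_add ?_ (abs_mulVec_le _ (w2 n) i))
  rw [Pi.neg_apply, abs_neg]
  exact w1 n i

/-- Bounds the compensator in `Φ⁽¹⁾`, so that silence of the first test bounds the residual power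
itself. -/
theorem exists_trace_secondMoment_bound (hP : P.Stable) (hI : I.Admissible μ) :
    ∃ T, 0 ≤ T ∧ ∀ n, (secondMoment μ fun ω => P.C₁ *ᵥ nominalError P I n ω - I.z n ω).trace
      ≤ T := by
  obtain ⟨R, hR⟩ := exists_nominalResidual_bound hP hI
  refine ⟨m * (R * R), mul_nonneg (Nat.cast_nonneg m) (mul_self_nonneg R), fun n => ?_⟩
  rw [Matrix.trace]
  refine (Finset.sum_le_sum (g := fun _ => R * R) fun i _ => ?_).trans (by simp)
  have := norm_integral_le_of_norm_le_const (μ := μ) (C := R * R)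
    (f := fun ω => nominalResidual P I n ω i * nominalResidual P I n ω i) (by
      filter_upwards [hR] with ω hω
      rw [norm_mul]
      exact mul_le_mul (hω n i) (hω n i) (abs_nonneg _) ((abs_nonneg _).trans (hω n i)))
  simp at this
  exact (le_abs_self _).trans this

/-! ### Detection from correlation with the private excitation. -/

section Excitation

/-- The σ-algebras generated by the excitation at each time and by all other random data. -/
abbrev excitationFamily (I : Inputs Ω p q m) (a : Attack Ω p m) (s : Signals Ω p m) :
    ℕ ⊕ Unit → MeasurableSpace Ω :=
  Sum.elim (fun n => MeasurableSpace.comap (I.e n) inferInstance)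
    (fun _ => MeasurableSpace.comap (exogenous I a s) inferInstance)

/-- The exogenous data are available at time `0`, the excitation `e_n` after time `n`. -/
def excitationTime : ℕ ⊕ Unit → ℕ := Sum.elim (fun n => n + 1) (fun _ => 0)

omit [IsProbabilityMeasure μ] in
theorem measurable_exogenous (hI : I.Admissible μ) (hpriv : PrivateExcitation μ I a s) :
    Measurable (exogenous I a s) :=
  (hpriv.measurable_x.prodMk (hpriv.measurable_x'.prodMk hpriv.measurable_ξ)).prodMk
    (measurable_pi_lambda _ fun n => (hI.process.measurable n).prodMk
      ((hI.measurement₁.measurable n).prodMk ((hI.measurement₂.measurable n).prodMk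
        ((hpriv.measurable_d n).prodMk (hpriv.measurable_ζ n)))))

omit [IsProbabilityMeasure μ] in
theorem excitationFamily_le (hI : I.Admissible μ) (hpriv : PrivateExcitation μ I a s)
    (k : ℕ ⊕ Unit) : excitationFamily I a s k ≤ mΩ := by
  cases k with
  | inl n => exact (hI.excitation.measurable n).comap_le
  | inr _ => exact (measurable_exogenous hI hpriv).comap_le

omit mΩ in
theorem iSup_comap_le {E : Type*} [MeasurableSpace E] (f : ℕ → Ω → E) :
    ⨆ n, MeasurableSpace.comap (f n) inferInstance
      ≤ MeasurableSpace.comap (fun ω n => f n ω) inferInstance :=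
  iSup_le fun n => ((measurable_pi_apply n).comp
    (comap_measurable fun (ω : Ω) (n : ℕ) => f n ω)).comap_le

/-- All exogenous data form a single member of the family, so their mutual dependence is irrelevant.
-/
theorem iIndep_excitationFamily (hI : I.Admissible μ) (hpriv : PrivateExcitation μ I a s) :
    iIndep (excitationFamily I a s) μ := by
  refine iIndep_sum hI.excitation.indep.iIndep iIndep.of_subsingleton ?_
  exact indep_of_indep_of_le ((IndepFun_iff_Indep _ _ _).1 hpriv.indep) (iSup_comap_le I.e)
    (iSup_le fun _ => le_rfl)

/-- If the attacker's gain is nonzero, then the attack is detected at all large times. -/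
theorem eventually_detection_of_gain_ne_zero (hP : P.Stable)
    (hlag : ∃ k : ℕ, P.C₁ * (P.A + P.B * P.K) ^ k * P.B ≠ 0) (hI : I.Admissible μ)
    (hpriv : PrivateExcitation μ I a s) (hloop : ClosedLoop P I a s) {ρ S : ℝ} {τ : ℕ}
    (hswitch : SwitchingRule μ P I s ρ S τ) (hγ : a.γ ≠ 0) :
    ∀ᵐ ω ∂μ, ∀ᶠ N in atTop, ω ∈ detection μ P I s ρ S N := by
  set H := P.C₁ * (P.A + P.B * P.K) ^ P.lag * P.B with hH
  set F := past (excitationFamily I a s) (excitationFamily_le hI hpriv) excitationTime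
  set G := innovation (excitationFamily I a s) excitationTime
  have hGF : ∀ n, G n ≤ F (n + 1) := innovation_le_past
  have hind : ∀ n, Indep (G n) (F n) μ := indep_innovation_past (iIndep_excitationFamily hI hpriv)
  have hW : ∀ n, Measurable[F n] (exogenous I a s) := fun n =>
    (comap_measurable _).mono (le_past (m := excitationFamily I a s) (k := Sum.inr ())
      (Nat.zero_le n)) le_rfl
  have heG : ∀ n, Measurable[G n] (I.e n) := fun n =>
    (comap_measurable _).mono (le_innovation (m := excitationFamily I a s) (k := Sum.inl n) rfl)
      le_rfl
  have heF : ∀ n, ∀ k < n, Measurable[F n] (I.e k) := fun n k hk =>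
    (comap_measurable _).mono (le_past (m := excitationFamily I a s) (k := Sum.inl k) hk) le_rfl
  obtain ⟨R, hR0, hR⟩ := hI.excitation.bounded.exists_coord_bound
  obtain ⟨T, hT0, hT⟩ := exists_trace_secondMoment_bound hP hI
  -- `Σ_E` is invertible, so `H Σ_E` inherits a nonzero entry from `H`; the second test is followed
  -- in that entry.
  obtain ⟨i, k, hik⟩ : ∃ i k, (H * secondMoment μ (I.e 0)) i k ≠ 0 := by
    by_contra! hc
    have h0 : H * secondMoment μ (I.e 0) = 0 := Matrix.ext hc
    have hu := hI.excitation_cov.isUnit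
    obtain ⟨u, hu⟩ := hu
    have : H = 0 := by
      rw [← Matrix.mul_one H, ← Units.mul_inv u, hu, ← Matrix.mul_assoc, h0, Matrix.zero_mul]
    exact Plant.lag_spec hlag this
  set c := (H * secondMoment μ (I.e 0)) i k with hc
  -- The predictable remainder. It has no a priori bound, hence the self-normalized law for `∑ Q_j
  -- e_j`.
  set Q : ℕ → Ω → ℝ := fun j ω =>
    (residual P I s (j + (P.lag + 1)) ω - a.γ • (H *ᵥ I.e j ω)) i with hQ
  have hQM : ∀ j, Measurable[F j] (Q j) := fun j =>
    measurable_coord i (measurable_residual_sub hloop hswitch (hW j) (heF j))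
  have lA := tendsto_sum_mul_div_energy F hGF hind hQM (fun n => measurable_coord k (heG n))
    (fun n => hR.mono fun ω h => h n k) (fun n => hI.excitation.mean_coord n k)
  set K : ℝ := ‖H‖ * (Fintype.card (Fin q) * R) with hK
  have hHe : ∀ᵐ ω ∂μ, ∀ j, |(H *ᵥ I.e j ω) i| ≤ K := hR.mono fun ω h j => abs_mulVec_le H (h j) i
  have hmean : ∀ j, ∫ ω, (H *ᵥ I.e j ω) i * I.e j ω k ∂μ = c := by
    intro j
    have hij : ∀ l, Integrable (fun ω => I.e j ω l * I.e j ω k) μ := fun l =>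
      integrable_of_ae_abs_le (R := R * R) ((measurable_coord l (hI.excitation.measurable j)).mul
        (measurable_coord k (hI.excitation.measurable j))) (by
          filter_upwards [hR] with ω hω
          rw [abs_mul]
          exact mul_le_mul (hω j l) (hω j k) (abs_nonneg _) hR0)
    simp only [mulVec, dotProduct, Finset.sum_mul, mul_assoc]
    rw [integral_finsetSum _ fun l _ => (hij l).const_mul _, hc, Matrix.mul_apply]
    refine Finset.sum_congr rfl fun l _ => ?_
    rw [integral_const_mul]
    congr 1
    have hm : Measurable fun v : Fin q → ℝ => v l * v k :=
      (measurable_pi_apply l).mul (measurable_pi_apply k)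
    exact ((hI.excitation.identDistrib j).comp hm).integral_eq
  have lB : ∀ᵐ ω ∂μ, Tendsto (fun J : ℕ => (1 / (J : ℝ)) * ∑ j ∈ Finset.range J,
      1 * ((H *ᵥ I.e j ω) i * I.e j ω k - c)) atTop (𝓝 0) := by
    have hbd : ∀ j, ∀ᵐ ω ∂μ, |(H *ᵥ I.e j ω) i * I.e j ω k| ≤ K * R := fun j => by
      filter_upwards [hHe, hR] with ω h1 h2
      rw [abs_mul]
      exact mul_le_mul (h1 j) (h2 j k) (abs_nonneg _) ((abs_nonneg _).trans (h1 j))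
    have hM : ∀ j, Measurable[G j] fun ω => (H *ᵥ I.e j ω) i * I.e j ω k := fun j =>
      (measurable_coord i (measurable_const_mulVec H (heG j))).mul (measurable_coord k (heG j))
    refine tendsto_average_mul F hGF hind (q := fun _ _ => 1) (R' := 1) (R := K * R + |c|)
      (fun _ => measurable_const) (fun j => (hM j).sub measurable_const)
      (fun _ => Eventually.of_forall fun _ => by simp) (fun j => ?_) fun j => ?_
    · filter_upwards [hbd j] with ω hω
      exact (abs_sub _ _).trans (by linarith)
    · rw [integral_sub (integrable_of_ae_abs_le ((hM j).mono ((hGF j).trans (F.le _)) le_rfl)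
        (hbd j)) (integrable_const _), hmean]
      simp
  filter_upwards [lA, lB, hHe] with ω hA hB hHe
  set c' := |a.γ * c| with hc'
  have hc'0 : 0 < c' := abs_pos.2 (mul_ne_zero hγ hik)
  -- Chosen so that `energy Q ≤ C N` when the first test is silent: `1 + J ≤ 2 N`, the residual
  -- power is at most `(m + T) N`, and the factors `2` come from `(x - y)² ≤ 2 x² + 2 y²`.
  set C : ℝ := 2 + 2 * (m + T) + 2 * (a.γ * K) ^ 2 with hC
  have hC0 : 0 < C := by positivity
  set d := P.lag + 1 with hd
  have evA : ∀ᶠ J in atTop, |∑ j ∈ Finset.range J, Q j ω * I.e j ω k|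
      ≤ c' / (8 * C) * energy (fun j => Q j ω) J := by
    filter_upwards [(tendsto_order.1 hA.abs).2 (c' / (8 * C)) (by simpa using by positivity)]
      with J hJ
    rw [abs_div, abs_of_pos (energy_pos _ J), div_lt_iff₀ (energy_pos _ J)] at hJ
    exact hJ.le
  have hratio : Tendsto (fun J : ℕ => (J : ℝ) / ((d + J : ℕ) : ℝ)) atTop (𝓝 1) := by
    have := tendsto_natCast_div_add_atTop (d : ℝ)
    refine this.congr fun J => ?_
    push_cast
    rw [add_comm]
  have evB : ∀ᶠ J : ℕ in atTop, c' / 2 ≤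
      |(1 / ((d + J : ℕ) : ℝ)) * (a.γ * ∑ j ∈ Finset.range J, (H *ᵥ I.e j ω) i * I.e j ω k)| := by
    have h1 : Tendsto (fun J : ℕ => (1 / ((d + J : ℕ) : ℝ)) *
        (a.γ * ∑ j ∈ Finset.range J, (H *ᵥ I.e j ω) i * I.e j ω k)) atTop (𝓝 (a.γ * c)) := by
      have h2 := hratio.mul ((hB.add_const c).const_mul a.γ)
      rw [zero_add, one_mul] at h2
      refine h2.congr' ?_
      filter_upwards [eventually_ge_atTop 1] with J hJ
      have hJ0 : (J : ℝ) ≠ 0 := by positivity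
      simp only [one_mul, Finset.sum_sub_distrib, Finset.sum_const, Finset.card_range,
        nsmul_eq_mul]
      have : ((d + J : ℕ) : ℝ) ≠ 0 := by positivity
      field_simp
      ring
    filter_upwards [(tendsto_order.1 h1.abs).1 (c' / 2) (by linarith)] with J hJ
    exact hJ.le
  have hsub : Tendsto (fun N => N - d) atTop atTop := tendsto_sub_atTop_nat d
  -- The bound `1` serves the power estimate from `Φ⁽¹⁾`, the bound `c' / 8` the entry of `Φ⁽²⁾`.
  -- With the remainder also at most `c' / 8`, the main term would be at most `c' / 4`, against its
  -- lower bound `c' / 2`.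
  have evt : ∀ᶠ N in atTop, threshold ρ S N < min 1 (c' / 8) :=
    (tendsto_order.1 (tendsto_threshold ρ S)).2 _ (by positivity)
  filter_upwards [evt, hsub.eventually evA, hsub.eventually evB, eventually_ge_atTop (d + 1)]
    with N h1 hJA hJB hN
  by_contra hnd
  simp only [detection, Set.mem_union, Set.mem_ofPred_eq, not_or, not_lt] at hnd
  obtain ⟨hΦ1, hΦ2⟩ := hnd
  obtain ⟨J, rfl⟩ := Nat.exists_eq_add_of_le (show d ≤ N by omega)
  rw [Nat.add_sub_cancel_left] at hJA hJB
  have ht1 := h1.trans_le (min_le_left _ _)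
  have ht2 := h1.trans_le (min_le_right _ _)
  set N' : ℝ := ((d + J : ℕ) : ℝ) with hN'
  have hN1 : 1 ≤ N' := by
    rw [hN']; exact_mod_cast (by omega : 1 ≤ d + J)
  have hNpos : 0 < N' := by linarith
  have hpow : ∑ n ∈ Finset.range (d + J), residual P I s n ω ⬝ᵥ residual P I s n ω
      ≤ (m + T) * N' := by
    have e1 := (abs_le.1 (abs_trace_le (Phi₁ μ P I s (d + J) ω))).2
    rw [trace_Phi₁] at e1
    have e2 : ∑ n ∈ Finset.range (d + J),
        (secondMoment μ fun ω' => P.C₁ *ᵥ nominalError P I n ω' - I.z n ω').trace ≤ N' * T := by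
      refine (Finset.sum_le_sum fun n _ => hT n).trans ?_
      simp [hN']
    have e3 : (m : ℝ) * ‖Phi₁ μ P I s (d + J) ω‖ ≤ m :=
      mul_le_of_le_one_right (Nat.cast_nonneg m) (by linarith)
    rw [← hN', ← mul_sub, one_div, inv_mul_le_iff₀ hNpos] at e1
    nlinarith
  have hen : energy (fun j => Q j ω) J ≤ C * N' := by
    have hJN : (J : ℝ) ≤ N' := by rw [hN']; exact_mod_cast (by omega : J ≤ d + J)
    have e1 : ∑ j ∈ Finset.range J, Q j ω ^ 2 ≤ ∑ j ∈ Finset.range J,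
        (2 * residual P I s (j + d) ω i ^ 2 + 2 * (a.γ * K) ^ 2) := by
      refine Finset.sum_le_sum fun j _ => ?_
      have e2 : (a.γ * (H *ᵥ I.e j ω) i) ^ 2 ≤ (a.γ * K) ^ 2 := by
        rw [mul_pow, mul_pow]
        exact mul_le_mul_of_nonneg_left
          (sq_le_sq' (abs_le.1 (hHe j)).1 (abs_le.1 (hHe j)).2) (sq_nonneg _)
      have e3 : Q j ω = residual P I s (j + d) ω i - a.γ * (H *ᵥ I.e j ω) i := rfl
      rw [e3]
      nlinarith [sq_nonneg (residual P I s (j + d) ω i + a.γ * (H *ᵥ I.e j ω) i)]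
    have e4 : ∑ j ∈ Finset.range J, residual P I s (j + d) ω i ^ 2
        ≤ ∑ n ∈ Finset.range (d + J), residual P I s n ω ⬝ᵥ residual P I s n ω := by
      rw [Finset.sum_range_add]
      refine le_add_of_nonneg_of_le (Finset.sum_nonneg fun n _ =>
        Finset.sum_nonneg fun _ _ => mul_self_nonneg _)
        (Finset.sum_le_sum fun j _ => ?_)
      rw [add_comm j d, dotProduct, sq]
      exact Finset.single_le_sum (f := fun l => residual P I s (d + j) ω l
        * residual P I s (d + j) ω l) (fun l _ => mul_self_nonneg _) (Finset.mem_univ i)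
    rw [Finset.sum_add_distrib, ← Finset.mul_sum, Finset.sum_const, Finset.card_range,
      nsmul_eq_mul] at e1
    have e5 : (J : ℝ) * (2 * (a.γ * K) ^ 2) ≤ N' * (2 * (a.γ * K) ^ 2) :=
      mul_le_mul_of_nonneg_right hJN (by positivity)
    rw [energy, hC]
    nlinarith
  have hentry : |Phi₂ P I s (d + J) ω i k| ≤ c' / 8 :=
    (norm_entry_le_l2_opNorm _ i k).trans (hΦ2.trans ht2.le)
  have hsplit : Phi₂ P I s (d + J) ω i k
      = (1 / N') * (a.γ * ∑ j ∈ Finset.range J, (H *ᵥ I.e j ω) i * I.e j ω k)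
        + (1 / N') * ∑ j ∈ Finset.range J, Q j ω * I.e j ω k := by
    rw [hd, Phi₂_apply, ← hd, ← hN', ← mul_add]
    congr 1
    rw [Finset.mul_sum, ← Finset.sum_add_distrib]
    refine Finset.sum_congr rfl fun j _ => ?_
    simp only [hQ, Pi.sub_apply, Pi.smul_apply, smul_eq_mul]
    ring
  have hsmall : |(1 / N') * ∑ j ∈ Finset.range J, Q j ω * I.e j ω k| ≤ c' / 8 := by
    rw [abs_mul, abs_of_pos (by positivity : 0 < 1 / N'), one_div, inv_mul_le_iff₀ hNpos]
    refine hJA.trans ((mul_le_mul_of_nonneg_left hen (by positivity)).trans (le_of_eq ?_))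
    field_simp
  have htri : |(1 / N') * (a.γ * ∑ j ∈ Finset.range J, (H *ᵥ I.e j ω) i * I.e j ω k)|
      ≤ c' / 8 + c' / 8 := by
    have : (1 / N') * (a.γ * ∑ j ∈ Finset.range J, (H *ᵥ I.e j ω) i * I.e j ω k)
      = Phi₂ P I s (d + J) ω i k - (1 / N') * ∑ j ∈ Finset.range J, Q j ω * I.e j ω k := by
      rw [hsplit]; ring
    rw [this]
    exact (abs_sub _ _).trans (add_le_add hentry hsmall)
  linarith

end Excitation

end Feedback

/-! ### Zero gain: superposition in the joint linear dynamics. -/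

section Additive

variable {Ω : Type*} {p q m : ℕ} {P : Plant p q m} {I : Inputs Ω p q m} {a : Attack Ω p m}
  {s : Signals Ω p m}

/-- The joint dynamics of the estimation error and the replayed state. -/
def loopMatrix (P : Plant p q m) : Matrix (Fin p ⊕ Fin p) (Fin p ⊕ Fin p) ℝ :=
  fromBlocks (P.A + P.L₁ * P.C₁) (-(P.L₁ * P.C₁)) 0 (P.A + P.B * P.K)

/-- The contribution of the estimation error and the replayed state to the residual. -/
def outMatrix (P : Plant p q m) : Matrix (Fin m) (Fin p ⊕ Fin p) ℝ := fromCols P.C₁ (-P.C₁)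

theorem loopMatrix_mulVec (P : Plant p q m) (u v : Fin p → ℝ) :
    loopMatrix P *ᵥ Sum.elim u v
      = Sum.elim ((P.A + P.L₁ * P.C₁) *ᵥ u - P.L₁ *ᵥ (P.C₁ *ᵥ v)) ((P.A + P.B * P.K) *ᵥ v) := by
  rw [loopMatrix, fromBlocks_mulVec, Sum.elim_comp_inl, Sum.elim_comp_inr, neg_mulVec, zero_mulVec,
    zero_add, ← mulVec_mulVec, sub_eq_add_neg]

theorem outMatrix_mulVec (P : Plant p q m) (u v : Fin p → ℝ) :
    outMatrix P *ᵥ Sum.elim u v = P.C₁ *ᵥ u - P.C₁ *ᵥ v := by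
  rw [outMatrix, fromCols_mulVec, Sum.elim_comp_inl, Sum.elim_comp_inr, neg_mulVec, sub_eq_add_neg]

theorem sumElim_add (u u' v v' : Fin p → ℝ) :
    Sum.elim (u + u') (v + v') = Sum.elim u v + Sum.elim u' v' := by
  ext (i | i) <;> rfl

theorem Plant.Stable.summable_loopMatrix (hP : P.Stable) :
    Summable fun k => ‖loopMatrix P ^ k‖ :=
  hP.observer₁.summable_fromBlocks hP.feedback _

/-- The input of the joint dynamics caused by the pair `(d, ζ)` of attack disturbances. -/
def drive (P : Plant p q m) (ν : (Fin p → ℝ) × (Fin m → ℝ)) : Fin p ⊕ Fin p → ℝ :=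
  Sum.elim (-(P.L₁ *ᵥ ν.2)) ν.1

/-- The joint state caused by the attack disturbances alone, from zero initial conditions. -/
def attackState (P : Plant p q m) (a : Attack Ω p m) : ℕ → Ω → Fin p ⊕ Fin p → ℝ
  | 0, _ => 0
  | n + 1, ω => loopMatrix P *ᵥ attackState P a n ω + drive P (a.d n ω, a.ζ n ω)

/-- The residual caused by the attack disturbances alone, from zero initial conditions. -/
def attackOutput (P : Plant p q m) (a : Attack Ω p m) (n : ℕ) (ω : Ω) : Fin m → ℝ :=
  outMatrix P *ᵥ attackState P a n ω - a.ζ n ω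

/-- The impulse response from the attack disturbances to the residual. -/
def response (P : Plant p q m) : ℕ → (Fin p → ℝ) × (Fin m → ℝ) → Fin m → ℝ
  | 0, ν => -ν.2
  | j + 1, ν => (outMatrix P * loopMatrix P ^ j) *ᵥ drive P ν

/-- Variation of constants; the upper limit `n + 1` includes the direct feedthrough `-ζ_n`, which is
the coefficient with index `0`. -/
theorem attackOutput_eq_sum (n : ℕ) (ω : Ω) : attackOutput P a n ω
    = ∑ k ∈ Finset.range (n + 1), response P (n - k) (a.d k ω, a.ζ k ω) := by
  have h := linear_recursion (M := loopMatrix P) (s := fun n => attackState P a n ω)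
    (b := fun n => drive P (a.d n ω, a.ζ n ω)) (fun _ => rfl) n
  have h' : attackState P a n ω = ∑ k ∈ Finset.range n,
      loopMatrix P ^ (n - 1 - k) *ᵥ drive P (a.d k ω, a.ζ k ω) := by
    refine h.trans ?_
    rw [attackState, mulVec_zero, zero_add]
  rw [attackOutput, h', Finset.sum_range_succ, Nat.sub_self, Matrix.mulVec_sum, sub_eq_add_neg]
  congr 1
  refine Finset.sum_congr rfl fun k hk => ?_
  have hk := Finset.mem_range.1 hk
  obtain ⟨j, hj⟩ : ∃ j, n - k = j + 1 := ⟨n - k - 1, by omega⟩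
  have hj' : n - 1 - k = j := by omega
  rw [hj, hj', response, mulVec_mulVec]

/-- The part of the joint state that is caused by all disturbances. -/
def noiseState (P : Plant p q m) (I : Inputs Ω p q m) (a : Attack Ω p m) (n : ℕ) (ω : Ω) :
    Fin p ⊕ Fin p → ℝ :=
  attackState P a n ω + Sum.elim (nominalError P I n ω) 0

theorem noiseState_succ (n : ℕ) (ω : Ω) : noiseState P I a (n + 1) ω
    = loopMatrix P *ᵥ noiseState P I a n ω
      + (drive P (a.d n ω, a.ζ n ω) + Sum.elim (-I.w n ω - P.L₁ *ᵥ I.z n ω) 0) := by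
  have e : Sum.elim (nominalError P I (n + 1) ω) (0 : Fin p → ℝ)
      = loopMatrix P *ᵥ Sum.elim (nominalError P I n ω) 0
        + Sum.elim (-I.w n ω - P.L₁ *ᵥ I.z n ω) 0 := by
    rw [loopMatrix_mulVec, ← sumElim_add, nominalError_succ]
    simp
  rw [noiseState, noiseState, e, attackState, mulVec_add]
  abel

theorem noiseOutput_eq (n : ℕ) (ω : Ω) :
    outMatrix P *ᵥ noiseState P I a n ω + (-I.z n ω - a.ζ n ω)
      = nominalResidual P I n ω + attackOutput P a n ω := by
  rw [noiseState, mulVec_add, outMatrix_mulVec, mulVec_zero, sub_zero, nominalResidual,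
    attackOutput]
  abel

/-- Superposition. The estimation error starts at zero, so `ξ_0` is the only initial value that
contributes. -/
theorem ClosedLoop.jointState_eq (hloop : ClosedLoop P I a s) (hγ : a.γ = 0) (n : ℕ) (ω : Ω) :
    Sum.elim (estimationError s n ω) (s.ξ n ω)
      = loopMatrix P ^ n *ᵥ Sum.elim 0 (s.ξ 0 ω) + noiseState P I a n ω := by
  induction n with
  | zero =>
    rw [hloop.estimationError_zero, pow_zero, one_mulVec, noiseState, attackState, nominalError]
    ext (i | i) <;> simp
  | succ n ih =>
    rw [noiseState_succ, pow_succ', ← mulVec_mulVec, ← add_assoc, ← mulVec_add, ← ih,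
      loopMatrix_mulVec, drive, ← sumElim_add, ← sumElim_add, hloop.estimationError_succ,
      hloop.replay, hloop.attack, hγ]
    congr 1
    · simp only [zero_smul, sub_zero, mulVec_add]
      abel
    · abel

theorem ClosedLoop.residual_eq_of_gain_eq_zero (hloop : ClosedLoop P I a s) (hγ : a.γ = 0) (n : ℕ)
    (ω : Ω) : residual P I s n ω
      = outMatrix P *ᵥ (loopMatrix P ^ n *ᵥ Sum.elim 0 (s.ξ 0 ω))
        + (outMatrix P *ᵥ noiseState P I a n ω + (-I.z n ω - a.ζ n ω)) := by
  rw [← add_assoc, ← mulVec_add, ← hloop.jointState_eq hγ, outMatrix_mulVec, residual_eq,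
    hloop.attack, hγ]
  simp only [zero_smul, sub_zero]
  abel

/-- If the attack disturbances leave no trace in the residual, then the attack is a free motion. -/
theorem ClosedLoop.attack_eq_of_attackOutput_eq_zero (hloop : ClosedLoop P I a s) (hγ : a.γ = 0)
    {ω : Ω} (h : ∀ n, attackOutput P a n ω = 0) (n : ℕ) :
    s.v n ω = P.C₁ *ᵥ ((P.A + P.B * P.K) ^ n *ᵥ s.ξ 0 ω) := by
  -- A zero output with zero error component forces `ζ_n = -C₁ u`. Then `C₁ u + ζ_n`, the input to
  -- the error through `L₁`, vanishes as well, and the error component stays zero. Here `u` is the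
  -- part of `ξ_n` due to the disturbances.
  have key : ∀ n, ∃ u : Fin p → ℝ, attackState P a n ω = Sum.elim (0 : Fin p → ℝ) u
      ∧ s.ξ n ω = (P.A + P.B * P.K) ^ n *ᵥ s.ξ 0 ω + u := by
    intro n
    induction n with
    | zero =>
      refine ⟨0, ?_, by simp⟩
      rw [attackState]
      ext (i | i) <;> rfl
    | succ n ih =>
      obtain ⟨u, h1, h2⟩ := ih
      refine ⟨(P.A + P.B * P.K) *ᵥ u + a.d n ω, ?_, ?_⟩
      · have h3 := h n
        rw [attackOutput, h1, outMatrix_mulVec, mulVec_zero, zero_sub] at h3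
        have h4 : a.ζ n ω = -(P.C₁ *ᵥ u) := (sub_eq_zero.1 h3).symm
        rw [attackState, h1, loopMatrix_mulVec, drive, ← sumElim_add, h4]
        congr 1
        simp only [mulVec_neg, mulVec_zero]
        abel
      · rw [hloop.replay, h2, mulVec_add, mulVec_mulVec, ← pow_succ']
        abel
  obtain ⟨u, h1, h2⟩ := key n
  have h3 := h n
  rw [attackOutput, h1, outMatrix_mulVec, mulVec_zero, zero_sub] at h3
  rw [hloop.attack, hγ, h2, mulVec_add, (sub_eq_zero.1 h3).symm]
  simp

end Additive

/-! ### Moments of the attack output and of the residual under zero gain. -/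

section AdditiveStatistics

variable {Ω : Type*} {p q m : ℕ} {P : Plant p q m} {I : Inputs Ω p q m} {a : Attack Ω p m}
  {s : Signals Ω p m}

theorem measurable_sumElim {𝓖 : MeasurableSpace Ω} {u v : Ω → Fin p → ℝ} (hu : Measurable[𝓖] u)
    (hv : Measurable[𝓖] v) : Measurable[𝓖] fun ω => Sum.elim (u ω) (v ω) :=
  measurable_pi_lambda _ fun i => by
    cases i with
    | inl i => exact measurable_coord i hu
    | inr i => exact measurable_coord i hv

theorem measurable_drive {𝓖 : MeasurableSpace Ω} {ν : Ω → (Fin p → ℝ) × (Fin m → ℝ)}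
    (hν : Measurable[𝓖] ν) : Measurable[𝓖] fun ω => drive P (ν ω) :=
  measurable_sumElim (measurable_const_mulVec _ hν.snd).neg hν.fst

theorem measurable_response {𝓖 : MeasurableSpace Ω} {ν : Ω → (Fin p → ℝ) × (Fin m → ℝ)} (j : ℕ)
    (hν : Measurable[𝓖] ν) : Measurable[𝓖] fun ω => response P j (ν ω) := by
  cases j with
  | zero => exact hν.snd.neg
  | succ j => exact measurable_const_mulVec _ (measurable_drive hν)

theorem measurable_attackOutput {𝓖 : MeasurableSpace Ω}
    (h : ∀ n, Measurable[𝓖] fun ω => (a.d n ω, a.ζ n ω)) (n : ℕ) :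
    Measurable[𝓖] (attackOutput P a n) := by
  rw [funext (attackOutput_eq_sum n)]
  exact Finset.measurable_sum _ fun k _ => measurable_response _ (h k)

theorem measurable_nominalResidual {𝓖 : MeasurableSpace Ω} (hw : ∀ n, Measurable[𝓖] (I.w n))
    (hz : ∀ n, Measurable[𝓖] (I.z n)) (n : ℕ) : Measurable[𝓖] (nominalResidual P I n) := by
  have h : ∀ n, Measurable[𝓖] (nominalError P I n) := by
    intro n
    induction n with
    | zero => exact measurable_const
    | succ n ih =>
      exact ((measurable_const_mulVec _ ih).sub (hw n)).sub (measurable_const_mulVec _ (hz n))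
  exact (measurable_const_mulVec _ (h n)).sub (hz n)

theorem abs_drive_le {ν : (Fin p → ℝ) × (Fin m → ℝ)} {R : ℝ} (hR0 : 0 ≤ R) (h1 : ∀ i, |ν.1 i| ≤ R)
    (h2 : ∀ i, |ν.2 i| ≤ R) (i : Fin p ⊕ Fin p) :
    |drive P ν i| ≤ ‖P.L₁‖ * (Fintype.card (Fin m) * R) + R := by
  have h3 : 0 ≤ ‖P.L₁‖ * (Fintype.card (Fin m) * R) := by positivity
  cases i with
  | inl i =>
    simp only [drive, Sum.elim_inl, Pi.neg_apply, abs_neg]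
    exact (abs_mulVec_le _ h2 i).trans (le_add_of_nonneg_right hR0)
  | inr i => exact (h1 i).trans (le_add_of_nonneg_left h3)

variable [mΩ : MeasurableSpace Ω] {μ : Measure Ω} [IsProbabilityMeasure μ]

omit [IsProbabilityMeasure μ] in
theorem Attack.IsWhite.exists_bound (h : a.IsWhite μ I) :
    ∃ R, 0 ≤ R ∧ ∀ᵐ ω ∂μ, ∀ n, (∀ i, |a.d n ω i| ≤ R) ∧ ∀ i, |a.ζ n ω i| ≤ R := by
  obtain ⟨R, hR⟩ := h.white.bounded
  refine ⟨max R 0, le_max_right _ _, ?_⟩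
  filter_upwards [ae_all_iff.2 hR] with ω hω n
  have h1 := (hω n).trans (le_max_left R 0)
  exact ⟨fun i => (norm_le_pi_norm (a.d n ω) i).trans ((norm_fst_le (a.d n ω, a.ζ n ω)).trans h1),
    fun i => (norm_le_pi_norm (a.ζ n ω) i).trans ((norm_snd_le (a.d n ω, a.ζ n ω)).trans h1)⟩

theorem Attack.IsWhite.integrable (h : a.IsWhite μ I) (n : ℕ) :
    Integrable (fun ω => (a.d n ω, a.ζ n ω)) μ := by
  obtain ⟨R, hR⟩ := h.white.bounded
  exact Integrable.of_bound (h.white.measurable n).aestronglyMeasurable R (hR n)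

theorem Attack.IsWhite.mean_d (h : a.IsWhite μ I) (n : ℕ) (i : Fin p) :
    ∫ ω, a.d n ω i ∂μ = 0 := by
  have := (((ContinuousLinearMap.proj i).comp
    (ContinuousLinearMap.fst ℝ (Fin p → ℝ) (Fin m → ℝ)))).integral_comp_comm (h.integrable n)
  rw [h.white.mean_zero n, map_zero] at this
  exact this

theorem Attack.IsWhite.mean_ζ (h : a.IsWhite μ I) (n : ℕ) (i : Fin m) :
    ∫ ω, a.ζ n ω i ∂μ = 0 := by
  have := (((ContinuousLinearMap.proj i).comp
    (ContinuousLinearMap.snd ℝ (Fin p → ℝ) (Fin m → ℝ)))).integral_comp_comm (h.integrable n)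
  rw [h.white.mean_zero n, map_zero] at this
  exact this

theorem Attack.IsWhite.integrable_coord (h : a.IsWhite μ I) (n : ℕ) :
    (∀ i, Integrable (fun ω => a.d n ω i) μ) ∧ ∀ i, Integrable (fun ω => a.ζ n ω i) μ :=
  ⟨fun i => (h.integrable n).fst.eval i, fun i => (h.integrable n).snd.eval i⟩

theorem Attack.IsWhite.mean_drive (h : a.IsWhite μ I) (n : ℕ) (i : Fin p ⊕ Fin p) :
    ∫ ω, drive P (a.d n ω, a.ζ n ω) i ∂μ = 0 := by
  cases i with
  | inl i =>
    simp only [drive, Sum.elim_inl, Pi.neg_apply]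
    rw [integral_neg, integral_mulVec_eq_zero _ (h.integrable_coord n).2 (h.mean_ζ n), neg_zero]
  | inr i => exact h.mean_d n i

theorem Attack.IsWhite.integrable_drive (h : a.IsWhite μ I) (n : ℕ) (i : Fin p ⊕ Fin p) :
    Integrable (fun ω => drive P (a.d n ω, a.ζ n ω) i) μ := by
  obtain ⟨R, hR0, hR⟩ := h.exists_bound
  refine integrable_of_ae_abs_le (measurable_coord i (measurable_drive (h.white.measurable n)))
    (hR.mono fun ω hω => abs_drive_le hR0 (hω n).1 (hω n).2 i)

theorem Attack.IsWhite.mean_response (h : a.IsWhite μ I) (j n : ℕ) (i : Fin m) :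
    ∫ ω, response P j (a.d n ω, a.ζ n ω) i ∂μ = 0 := by
  cases j with
  | zero =>
    simp only [response, Pi.neg_apply]
    rw [integral_neg, h.mean_ζ, neg_zero]
  | succ j => exact integral_mulVec_eq_zero _ (h.integrable_drive n) (h.mean_drive n) i

theorem Attack.IsWhite.memLp_response (h : a.IsWhite μ I) (j n : ℕ) (i : Fin m) :
    MemLp (fun ω => response P j (a.d n ω, a.ζ n ω) i) 2 μ := by
  obtain ⟨R, hR0, hR⟩ := h.exists_bound
  have hm : AEStronglyMeasurable (fun ω => response P j (a.d n ω, a.ζ n ω) i) μ :=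
    (measurable_coord i (measurable_response j (h.white.measurable n))).aestronglyMeasurable
  cases j with
  | zero =>
    refine MemLp.of_bound hm R (hR.mono fun ω hω => ?_)
    simpa [response] using (hω n).2 i
  | succ j =>
    exact MemLp.of_bound hm _ (hR.mono fun ω hω =>
      abs_mulVec_le _ (abs_drive_le hR0 (hω n).1 (hω n).2) i)

theorem Attack.IsWhite.memLp_attackOutput (h : a.IsWhite μ I) (n : ℕ) (i : Fin m) :
    MemLp (fun ω => attackOutput P a n ω i) 2 μ := by
  simp only [attackOutput_eq_sum, Finset.sum_apply]
  exact memLp_finsetSum _ fun k _ => h.memLp_response (n - k) k i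

theorem Attack.IsWhite.mean_attackOutput (h : a.IsWhite μ I) (n : ℕ) (i : Fin m) :
    ∫ ω, attackOutput P a n ω i ∂μ = 0 := by
  simp only [attackOutput_eq_sum, Finset.sum_apply]
  rw [integral_finsetSum _ fun k _ => (h.memLp_response (n - k) k i).integrable (by norm_num)]
  exact Finset.sum_eq_zero fun k _ => h.mean_response _ _ _

omit [IsProbabilityMeasure μ] in
theorem Attack.IsWhite.integral_response_sq (h : a.IsWhite μ I) (j n : ℕ) (i : Fin m) :
    ∫ ω, response P j (a.d n ω, a.ζ n ω) i ^ 2 ∂μ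
      = ∫ ω, response P j (a.d 0 ω, a.ζ 0 ω) i ^ 2 ∂μ := by
  have hm : Measurable fun ν : (Fin p → ℝ) × (Fin m → ℝ) => response P j ν i ^ 2 :=
    (measurable_coord i (measurable_response j measurable_id)).pow_const 2
  exact ((h.white.identDistrib n).comp hm).integral_eq

/-- Every impulse response coefficient gives a lower bound for the power of the attack output. -/
theorem Attack.IsWhite.integral_response_sq_le (h : a.IsWhite μ I) {j n : ℕ} (hjn : j ≤ n)
    (i : Fin m) : ∫ ω, response P j (a.d 0 ω, a.ζ 0 ω) i ^ 2 ∂μ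
      ≤ ∫ ω, attackOutput P a n ω i ^ 2 ∂μ := by
  set Y : ℕ → Ω → ℝ := fun k ω => response P (n - k) (a.d k ω, a.ζ k ω) i with hY
  have hsum : (fun ω => attackOutput P a n ω i) = ∑ k ∈ Finset.range (n + 1), Y k := by
    funext ω
    rw [attackOutput_eq_sum, Finset.sum_apply, Finset.sum_apply]
  have hind : Set.Pairwise ↑(Finset.range (n + 1)) fun k l => Y k ⟂ᵢ[μ] Y l := by
    intro k _ l _ hkl
    exact (h.white.indep.indepFun hkl).comp
      (φ := fun ν => response P (n - k) ν i) (ψ := fun ν => response P (n - l) ν i)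
      (measurable_coord i (measurable_response _ measurable_id))
      (measurable_coord i (measurable_response _ measurable_id))
  -- The output at time `n` is a sum of independent centered responses, so variances add; only the
  -- one of the disturbance at time `n - j` is kept.
  have hvar := IndepFun.variance_sum (μ := μ) (fun k _ => h.memLp_response (P := P) (n - k) k i)
    hind
  rw [← hsum, variance_of_integral_eq_zero (h.memLp_attackOutput n i).aemeasurable
    (h.mean_attackOutput n i)] at hvar
  rw [hvar, ← h.integral_response_sq j (n - j) i]
  have h1 : n - (n - j) = j := by omega
  have h2 : ∫ ω, response P j (a.d (n - j) ω, a.ζ (n - j) ω) i ^ 2 ∂μ = variance (Y (n - j)) μ := by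
    rw [variance_of_integral_eq_zero (h.memLp_response _ _ _).aemeasurable (h.mean_response _ _ _)]
    simp only [h1]
  rw [h2]
  exact Finset.single_le_sum (f := fun k => variance (Y k) μ) (fun k _ => variance_nonneg _ _)
    (Finset.mem_range.2 (by omega))

/-- By identical distribution, a vanishing second moment at time `0` kills the corresponding
response to the disturbance at every time. -/
theorem Attack.IsWhite.ae_attackOutput_eq_zero (h : a.IsWhite μ I)
    (h0 : ∀ j i, ∫ ω, response P j (a.d 0 ω, a.ζ 0 ω) i ^ 2 ∂μ = 0) :
    ∀ᵐ ω ∂μ, ∀ n, attackOutput P a n ω = 0 := by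
  have h1 : ∀ j k i, ∀ᵐ ω ∂μ, response P j (a.d k ω, a.ζ k ω) i = 0 := by
    intro j k i
    have h2 := h0 j i
    rw [← h.integral_response_sq j k i, integral_eq_zero_iff_of_nonneg (fun ω => sq_nonneg _)
      (h.memLp_response j k i).integrable_sq] at h2
    filter_upwards [h2] with ω hω
    exact pow_eq_zero_iff two_ne_zero |>.1 hω
  filter_upwards [ae_all_iff.2 fun j => ae_all_iff.2 fun k => ae_all_iff.2 fun i => h1 j k i]
    with ω hω n
  rw [attackOutput_eq_sum]
  exact Finset.sum_eq_zero fun k _ => funext fun i => hω _ _ _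

theorem memLp_nominalResidual (hP : P.Stable) (hI : I.Admissible μ) (n : ℕ) (i : Fin m) :
    MemLp (fun ω => nominalResidual P I n ω i) 2 μ := by
  obtain ⟨R, hR⟩ := exists_nominalResidual_bound hP hI
  exact MemLp.of_bound (measurable_coord i (measurable_nominalResidual hI.process.measurable
    hI.measurement₁.measurable n)).aestronglyMeasurable R (hR.mono fun ω h => h n i)

/-- The disturbances of an attacker with zero gain increase the expected power of the residual. -/
theorem integral_noiseOutput_sq (hP : P.Stable) (hI : I.Admissible μ) (h : a.IsWhite μ I) (n : ℕ) :
    ∫ ω, (outMatrix P *ᵥ noiseState P I a n ω + (-I.z n ω - a.ζ n ω))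
        ⬝ᵥ (outMatrix P *ᵥ noiseState P I a n ω + (-I.z n ω - a.ζ n ω)) ∂μ
      = (secondMoment μ fun ω => P.C₁ *ᵥ nominalError P I n ω - I.z n ω).trace
        + ∑ i, ∫ ω, attackOutput P a n ω i ^ 2 ∂μ := by
  have hc := fun i => h.memLp_attackOutput (P := P) n i
  have hε := fun i => memLp_nominalResidual hP hI n i
  -- The attack output is centered and independent of the plant noises, so no cross term can mask
  -- its power.
  have hzero : ∀ i, ∫ ω, nominalResidual P I n ω i * attackOutput P a n ω i ∂μ = 0 := by
    intro i
    have hm1 : ∀ k, Measurable[MeasurableSpace.comap (fun ω n => (a.d n ω, a.ζ n ω)) inferInstance]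
        fun ω => (a.d k ω, a.ζ k ω) := fun k =>
      (measurable_pi_apply k).comp (comap_measurable fun (ω : Ω) (n : ℕ) => (a.d n ω, a.ζ n ω))
    have hm2 : ∀ k, Measurable[MeasurableSpace.comap (fun ω n => (I.w n ω, I.z n ω, I.η n ω))
        inferInstance] fun ω => (I.w k ω, I.z k ω, I.η k ω) := fun k =>
      (measurable_pi_apply k).comp
        (comap_measurable fun (ω : Ω) (n : ℕ) => (I.w n ω, I.z n ω, I.η n ω))
    refine integral_mul_eq_zero_of_indep ((IndepFun_iff_Indep _ _ _).1 h.indep) ?_ ?_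
      (measurable_coord i (measurable_attackOutput hm1 n))
      (measurable_coord i (measurable_nominalResidual (fun k => (hm2 k).fst)
        (fun k => (hm2 k).snd.fst) n)) (h.mean_attackOutput n i)
    · exact (measurable_pi_lambda _ fun k => h.white.measurable k).comap_le
    · exact (measurable_pi_lambda _ fun k => (hI.process.measurable k).prodMk
        ((hI.measurement₁.measurable k).prodMk (hI.measurement₂.measurable k))).comap_le
  have e : ∀ ω, (outMatrix P *ᵥ noiseState P I a n ω + (-I.z n ω - a.ζ n ω))
        ⬝ᵥ (outMatrix P *ᵥ noiseState P I a n ω + (-I.z n ω - a.ζ n ω))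
      = ∑ i, (nominalResidual P I n ω i ^ 2 + 2 * (nominalResidual P I n ω i * attackOutput P a n ω i)
        + attackOutput P a n ω i ^ 2) := by
    intro ω
    rw [noiseOutput_eq, dotProduct]
    refine Finset.sum_congr rfl fun i _ => ?_
    rw [Pi.add_apply]
    ring
  simp only [e]
  have i2 : ∀ i, Integrable (fun ω => 2 * (nominalResidual P I n ω i * attackOutput P a n ω i)) μ :=
    fun i => ((hε i).integrable_mul (hc i)).const_mul 2
  have i12 : ∀ i, Integrable (fun ω => nominalResidual P I n ω i ^ 2
      + 2 * (nominalResidual P I n ω i * attackOutput P a n ω i)) μ :=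
    fun i => (hε i).integrable_sq.add (i2 i)
  have i123 : ∀ i, Integrable (fun ω => nominalResidual P I n ω i ^ 2
      + 2 * (nominalResidual P I n ω i * attackOutput P a n ω i) + attackOutput P a n ω i ^ 2) μ :=
    fun i => (i12 i).add (hc i).integrable_sq
  rw [integral_finsetSum _ fun i _ => i123 i, Matrix.trace,
    ← Finset.sum_add_distrib]
  refine Finset.sum_congr rfl fun i _ => ?_
  rw [integral_add (i12 i) (hc i).integrable_sq, integral_add (hε i).integrable_sq (i2 i),
    integral_const_mul, hzero, mul_zero, add_zero, Matrix.diag_apply, secondMoment, Matrix.of_apply]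
  simp only [sq]
  rfl

end AdditiveStatistics

/-! ### Detection from the residual power under zero gain. -/

section ZeroGain

variable {Ω : Type*} {p q m : ℕ} {P : Plant p q m} {I : Inputs Ω p q m} {a : Attack Ω p m}
  {s : Signals Ω p m} [mΩ : MeasurableSpace Ω] {μ : Measure Ω} [IsProbabilityMeasure μ]

/-- The σ-algebras generated by process noise, measurement noise and attack disturbances. -/
abbrev disturbanceFamily (I : Inputs Ω p q m) (a : Attack Ω p m) :
    (ℕ ⊕ ℕ) ⊕ ℕ → MeasurableSpace Ω :=
  Sum.elim (Sum.elim (fun n => MeasurableSpace.comap (I.w n) inferInstance)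
    (fun n => MeasurableSpace.comap (I.z n) inferInstance))
    (fun n => MeasurableSpace.comap (fun ω => (a.d n ω, a.ζ n ω)) inferInstance)

/-- Disturbances with index `n` are available after time `n`. -/
def disturbanceTime : (ℕ ⊕ ℕ) ⊕ ℕ → ℕ :=
  Sum.elim (Sum.elim (fun n => n + 1) (fun n => n + 1)) (fun n => n + 1)

omit [IsProbabilityMeasure μ] in
theorem disturbanceFamily_le (hI : I.Admissible μ) (h : a.IsWhite μ I) (k : (ℕ ⊕ ℕ) ⊕ ℕ) :
    disturbanceFamily I a k ≤ mΩ := by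
  rcases k with (n | n) | n
  · exact (hI.process.measurable n).comap_le
  · exact (hI.measurement₁.measurable n).comap_le
  · exact (h.white.measurable n).comap_le

omit [IsProbabilityMeasure μ] in
-- The noise `η` is left out: it may depend on `z`, and the residual does not involve it when the
-- gain is zero.
theorem iIndep_disturbanceFamily (hI : I.Admissible μ) (h : a.IsWhite μ I) :
    iIndep (disturbanceFamily I a) μ := by
  refine iIndep_sum (iIndep_sum hI.process.indep.iIndep hI.measurement₁.indep.iIndep ?_)
    h.white.indep.iIndep ?_
  · refine indep_of_indep_of_le ((IndepFun_iff_Indep _ _ _).1 hI.indep) (iSup_comap_le I.w)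
      (iSup_le fun n => ?_)
    have : Measurable[MeasurableSpace.comap (fun ω n => (I.z n ω, I.η n ω)) inferInstance]
        fun ω => (I.z n ω, I.η n ω) :=
      (measurable_pi_apply n).comp (comap_measurable fun (ω : Ω) (n : ℕ) => (I.z n ω, I.η n ω))
    exact this.fst.comap_le
  · refine indep_of_indep_of_le ((IndepFun_iff_Indep _ _ _).1 h.indep).symm (iSup_le fun k => ?_)
      (iSup_comap_le fun n ω => (a.d n ω, a.ζ n ω))
    have : ∀ n, Measurable[MeasurableSpace.comap (fun ω n => (I.w n ω, I.z n ω, I.η n ω))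
        inferInstance] fun ω => (I.w n ω, I.z n ω, I.η n ω) := fun n =>
      (measurable_pi_apply n).comp
        (comap_measurable fun (ω : Ω) (n : ℕ) => (I.w n ω, I.z n ω, I.η n ω))
    cases k with
    | inl n => exact (this n).fst.comap_le
    | inr n => exact (this n).snd.fst.comap_le

/-- A nontrivial attack with zero gain has a nonzero impulse response coefficient. -/
theorem exists_response_ne_zero (hP : P.Stable) (hloop : ClosedLoop P I a s) (hγ : a.γ = 0)
    (h : a.IsWhite μ I) (hnontrivial : ¬ ∀ᵐ ω ∂μ, ∀ n, s.v n ω = 0)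
    (halt : (∀ᵐ ω ∂μ, s.ξ 0 ω = 0) ∨ ¬ ZeroAveragePower μ s.v) :
    ∃ j i, 0 < ∫ ω, response P j (a.d 0 ω, a.ζ 0 ω) i ^ 2 ∂μ := by
  by_contra! hc
  have h0 := h.ae_attackOutput_eq_zero (P := P) fun j i =>
    le_antisymm (hc j i) (integral_nonneg fun _ => sq_nonneg _)
  -- Without a response the attack is a free motion of a Schur stable matrix: it is zero if `ξ_0 =
  -- 0`, and in general it decays, so its average power tends to zero.
  rcases halt with hξ | hZ
  · refine hnontrivial ?_
    filter_upwards [h0, hξ] with ω h1 h2 n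
    rw [hloop.attack_eq_of_attackOutput_eq_zero hγ h1, h2, mulVec_zero, mulVec_zero]
  · refine hZ ?_
    filter_upwards [h0] with ω h1
    have hv : Tendsto (fun n => s.v n ω) atTop (𝓝 0) := by
      have h2 : Continuous fun u : Fin p → ℝ => P.C₁ *ᵥ u :=
        continuous_const.matrix_mulVec continuous_id
      have h3 := (h2.tendsto 0).comp (tendsto_pow_mulVec hP.feedback.summable (s.ξ 0 ω))
      rw [mulVec_zero] at h3
      exact h3.congr fun n => (hloop.attack_eq_of_attackOutput_eq_zero hγ h1 n).symm
    have h4 : Continuous fun u : Fin m → ℝ => u ⬝ᵥ u := continuous_id.dotProduct continuous_id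
    have h5 := ((h4.tendsto 0).comp hv).cesaro
    rw [zero_dotProduct] at h5
    simpa [one_div] using h5

/-- A nontrivial attack with zero gain is detected at all large times. -/
theorem eventually_detection_of_gain_eq_zero (hP : P.Stable) (hI : I.Admissible μ)
    (hloop : ClosedLoop P I a s) (ρ S : ℝ) (hγ : a.γ = 0)
    (h : a.IsWhite μ I) (hnontrivial : ¬ ∀ᵐ ω ∂μ, ∀ n, s.v n ω = 0)
    (halt : (∀ᵐ ω ∂μ, s.ξ 0 ω = 0) ∨ ¬ ZeroAveragePower μ s.v) :
    ∀ᵐ ω ∂μ, ∀ᶠ N in atTop, ω ∈ detection μ P I s ρ S N := by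
  obtain ⟨j, i, hji⟩ := exists_response_ne_zero hP hloop hγ h hnontrivial halt
  set c := ∫ ω, response P j (a.d 0 ω, a.ζ 0 ω) i ^ 2 ∂μ with hc
  set F := past (disturbanceFamily I a) (disturbanceFamily_le hI h) disturbanceTime
  set G := innovation (disturbanceFamily I a) disturbanceTime
  have hGF : ∀ n, G n ≤ F (n + 1) := innovation_le_past
  have hind : ∀ n, Indep (G n) (F n) μ := indep_innovation_past (iIndep_disturbanceFamily hI h)
  have hwG : ∀ n, Measurable[G n] (I.w n) := fun n => (comap_measurable _).mono
    (le_innovation (m := disturbanceFamily I a) (k := Sum.inl (Sum.inl n)) rfl) le_rfl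
  have hzG : ∀ n, Measurable[G n] (I.z n) := fun n => (comap_measurable _).mono
    (le_innovation (m := disturbanceFamily I a) (k := Sum.inl (Sum.inr n)) rfl) le_rfl
  have hνG : ∀ n, Measurable[G n] fun ω => (a.d n ω, a.ζ n ω) := fun n => (comap_measurable _).mono
    (le_innovation (m := disturbanceFamily I a) (k := Sum.inr n) rfl) le_rfl
  set b : ℕ → Ω → Fin p ⊕ Fin p → ℝ := fun n ω =>
    drive P (a.d n ω, a.ζ n ω) + Sum.elim (-I.w n ω - P.L₁ *ᵥ I.z n ω) 0 with hb
  set g : ℕ → Ω → Fin m → ℝ := fun n ω => -I.z n ω - a.ζ n ω with hg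
  obtain ⟨R₁, h10, h1⟩ := hI.process.bounded.exists_coord_bound
  obtain ⟨R₂, h20, h2⟩ := hI.measurement₁.bounded.exists_coord_bound
  obtain ⟨R₃, h30, h3⟩ := h.exists_bound
  set B₁ := ‖P.L₁‖ * (Fintype.card (Fin m) * R₃) + R₃
    + (R₁ + ‖P.L₁‖ * (Fintype.card (Fin m) * R₂)) with hB1
  have hB10 : 0 ≤ B₁ := by positivity
  have hbR : ∀ᵐ ω ∂μ, ∀ n k, |b n ω k| ≤ B₁ := by
    filter_upwards [h1, h2, h3] with ω w1 w2 w3 n k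
    refine (abs_add_le _ _).trans (add_le_add (abs_drive_le h30 (w3 n).1 (w3 n).2 k) ?_)
    cases k with
    | inl k =>
      refine (abs_sub _ _).trans (add_le_add ?_ (abs_mulVec_le _ (w2 n) k))
      rw [Pi.neg_apply, abs_neg]
      exact w1 n k
    | inr k =>
      simp only [Sum.elim_inr, Pi.zero_apply, abs_zero]
      positivity
  have hgR : ∀ᵐ ω ∂μ, ∀ n k, |g n ω k| ≤ R₂ + R₃ := by
    filter_upwards [h2, h3] with ω w2 w3 n k
    refine (abs_sub _ _).trans (add_le_add ?_ ((w3 n).2 k))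
    rw [Pi.neg_apply, abs_neg]
    exact w2 n k
  have hb0 : ∀ n k, ∫ ω, b n ω k ∂μ = 0 := by
    intro n k
    simp only [hb, Pi.add_apply]
    cases k with
    | inl k =>
      simp only [Sum.elim_inl, Pi.sub_apply, Pi.neg_apply]
      have iw := ((hI.process.integrable_coord n).eval k).neg
      have iz := fun l => (hI.measurement₁.integrable_coord n).eval l
      have iLz : Integrable (fun ω => (P.L₁ *ᵥ I.z n ω) k) μ := by
        simp only [mulVec, dotProduct]
        exact integrable_finsetSum _ fun l _ => (iz l).const_mul _
      have iwz : Integrable (fun ω => -I.w n ω k - (P.L₁ *ᵥ I.z n ω) k) μ := iw.sub iLz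
      have iw' : Integrable (fun ω => -I.w n ω k) μ := iw
      rw [integral_add (h.integrable_drive n (Sum.inl k)) iwz, h.mean_drive,
        integral_sub iw' iLz, integral_neg, hI.process.mean_coord,
        integral_mulVec_eq_zero _ iz (hI.measurement₁.mean_coord n)]
      simp
    | inr k => simpa using h.mean_drive (P := P) n (Sum.inr k)
  have hg0 : ∀ n k, ∫ ω, g n ω k ∂μ = 0 := by
    intro n k
    simp only [hg, Pi.sub_apply, Pi.neg_apply]
    have iz : Integrable (fun ω => -I.z n ω k) μ :=
      ((hI.measurement₁.integrable_coord n).eval k).neg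
    rw [integral_sub iz ((h.integrable_coord n).2 k), integral_neg, h.mean_ζ,
      hI.measurement₁.mean_coord]
    simp
  have hs0 : ∀ ω, noiseState P I a 0 ω = 0 := fun ω => by
    rw [noiseState, attackState, nominalError]
    ext (k | k) <;> simp
  set X : ℕ → Ω → Fin m → ℝ := fun n ω => outMatrix P *ᵥ noiseState P I a n ω + g n ω with hX
  have lln := tendsto_average_sq_output F hGF hind hP.summable_loopMatrix (outMatrix P)
    (b := b) (g := g) (R := max B₁ (R₂ + R₃))
    (fun n => (measurable_drive (hνG n)).add (measurable_sumElim
      ((hwG n).neg.sub (measurable_const_mulVec _ (hzG n))) measurable_const))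
    (fun n => (hzG n).neg.sub (hνG n).snd)
    (fun n => hbR.mono fun ω hω k => (hω n k).trans (le_max_left _ _))
    (fun n => hgR.mono fun ω hω k => (hω n k).trans (le_max_right _ _))
    hb0 hg0 hs0 (fun n ω => noiseState_succ n ω)
  filter_upwards [lln, hbR, hgR] with ω hlln hbω hgω
  -- The transient from `ξ_0` is treated pathwise; it decays and `X` is bounded, so no independence
  -- or integrability of `ξ_0` is needed.
  set ι₀ : ℕ → Fin m → ℝ := fun n => outMatrix P *ᵥ (loopMatrix P ^ n *ᵥ Sum.elim 0 (s.ξ 0 ω))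
    with hι₀
  have hι : Tendsto ι₀ atTop (𝓝 0) := by
    have c1 : Continuous fun u : Fin p ⊕ Fin p → ℝ => outMatrix P *ᵥ u :=
      continuous_const.matrix_mulVec continuous_id
    have c2 := (c1.tendsto 0).comp
      (tendsto_pow_mulVec hP.summable_loopMatrix (Sum.elim 0 (s.ξ 0 ω)))
    rw [mulVec_zero] at c2
    exact c2
  obtain ⟨B, hXB⟩ : ∃ B, ∀ n k, |X n ω k| ≤ B :=
    ⟨_, fun n k => (abs_add_le _ _).trans (add_le_add (abs_mulVec_le _ (fun l =>
      abs_linear_recursion_le hP.summable_loopMatrix (s := fun n => noiseState P I a n ω)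
        (b := fun n => b n ω) (fun n => noiseState_succ n ω) (hs0 ω) hB10 hbω n l) k) (hgω n k))⟩
  have hres : ∀ n, residual P I s n ω = ι₀ n + X n ω := fun n =>
    hloop.residual_eq_of_gain_eq_zero hγ n ω
  have hdiff : Tendsto (fun n => residual P I s n ω ⬝ᵥ residual P I s n ω - X n ω ⬝ᵥ X n ω)
      atTop (𝓝 0) := by
    have t1 : Tendsto (fun n => ∑ k, ι₀ n k * (ι₀ n k + 2 * X n ω k)) atTop (𝓝 0) := by
      suffices t0 : ∀ k, Tendsto (fun n => ι₀ n k * (ι₀ n k + 2 * X n ω k)) atTop (𝓝 0) by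
        simpa using tendsto_finsetSum Finset.univ fun k _ => t0 k
      intro k
      have t2 : Tendsto (fun n => ι₀ n k) atTop (𝓝 0) := (tendsto_pi_nhds.1 hι) k
      have t3 : Tendsto (fun n => ι₀ n k * (2 * X n ω k)) atTop (𝓝 0) :=
        t2.zero_mul_isBoundedUnder_le (isBoundedUnder_of ⟨2 * B, fun n => by
          rw [Function.comp_apply, norm_mul, Real.norm_eq_abs, abs_two, Real.norm_eq_abs]
          exact mul_le_mul_of_nonneg_left (hXB n k) zero_le_two⟩)
      have t4 := (t2.mul t2).add t3
      simp only [mul_zero, add_zero] at t4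
      exact t4.congr fun n => by ring
    refine t1.congr fun n => ?_
    rw [hres, dotProduct, dotProduct, ← Finset.sum_sub_distrib]
    refine Finset.sum_congr rfl fun k _ => ?_
    rw [Pi.add_apply]
    ring
  have hlim : Tendsto (fun N : ℕ => (1 / (N : ℝ)) * ∑ n ∈ Finset.range N,
      (residual P I s n ω ⬝ᵥ residual P I s n ω - ∫ ω', X n ω' ⬝ᵥ X n ω' ∂μ)) atTop (𝓝 0) := by
    have t1 := hdiff.cesaro.add hlln
    rw [zero_add] at t1
    refine t1.congr fun N => ?_
    rw [one_div, ← mul_add, ← Finset.sum_add_distrib]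
    congr 1
    refine Finset.sum_congr rfl fun n _ => ?_
    simp only [hX]
    ring
  have hpow : ∀ n, ∫ ω', X n ω' ⬝ᵥ X n ω' ∂μ
      = (secondMoment μ fun ω => P.C₁ *ᵥ nominalError P I n ω - I.z n ω).trace
        + ∑ k, ∫ ω, attackOutput P a n ω k ^ 2 ∂μ := fun n => integral_noiseOutput_sq hP hI h n
  have hlow : ∀ n, j ≤ n → c ≤ ∑ k, ∫ ω, attackOutput P a n ω k ^ 2 ∂μ := fun n hn =>
    (h.integral_response_sq_le hn i).trans (Finset.single_le_sum
      (f := fun k => ∫ ω, attackOutput P a n ω k ^ 2 ∂μ)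
      (fun k _ => integral_nonneg fun _ => sq_nonneg _) (Finset.mem_univ i))
  have ev1 := (tendsto_order.1 hlim).1 (-(c / 4)) (by linarith)
  have ev2 : ∀ᶠ N in atTop, m * threshold ρ S N < c / 4 := by
    have := (tendsto_threshold ρ S).const_mul (m : ℝ)
    rw [mul_zero] at this
    exact (tendsto_order.1 this).2 _ (by linarith)
  -- For `N ≥ 2 j + 1` at least half of the indices below `N` are `≥ j`, so the averaged attack
  -- power is at least `c / 2`. With fluctuation above `-c / 4`, the trace of `Φ⁽¹⁾` exceeds `c /
  -- 4`, hence also `m` times the threshold.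
  filter_upwards [ev1, ev2, eventually_ge_atTop (2 * j + 1)] with N e1 e2 hN
  by_contra hnd
  simp only [detection, Set.mem_union, Set.mem_ofPred_eq, not_or, not_lt] at hnd
  have e3 := (abs_le.1 (abs_trace_le (Phi₁ μ P I s N ω))).2
  have e4 : (m : ℝ) * ‖Phi₁ μ P I s N ω‖ ≤ m * threshold ρ S N :=
    mul_le_mul_of_nonneg_left hnd.1 (Nat.cast_nonneg m)
  obtain ⟨J, rfl⟩ := Nat.exists_eq_add_of_le (show j ≤ N by omega)
  have hNpos : (0 : ℝ) < ((j + J : ℕ) : ℝ) := by exact_mod_cast (by omega : 0 < j + J)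
  have e5 : c / 2 ≤ (1 / ((j + J : ℕ) : ℝ)) * ∑ n ∈ Finset.range (j + J),
      ∑ k, ∫ ω, attackOutput P a n ω k ^ 2 ∂μ := by
    rw [one_div, le_inv_mul_iff₀ hNpos, Finset.sum_range_add]
    have f1 : (0 : ℝ) ≤ ∑ n ∈ Finset.range j, ∑ k, ∫ ω, attackOutput P a n ω k ^ 2 ∂μ :=
      Finset.sum_nonneg fun n _ => Finset.sum_nonneg fun k _ => integral_nonneg fun _ =>
        sq_nonneg _
    have f2 : (J : ℝ) * c ≤ ∑ n ∈ Finset.range J,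
        ∑ k, ∫ ω, attackOutput P a (j + n) ω k ^ 2 ∂μ := by
      refine le_trans (by simp) (Finset.sum_le_sum (f := fun _ => c) fun n _ =>
        hlow (j + n) (by omega))
    have f3 : (j : ℝ) ≤ J := by exact_mod_cast (by omega : j ≤ J)
    push_cast
    nlinarith
  rw [trace_Phi₁] at e3
  simp only [hpow, Finset.sum_sub_distrib, Finset.sum_add_distrib] at e1
  rw [mul_sub, mul_add] at e1
  linarith

end ZeroGain

end Watermark

theorem mainTheorem3 {Ω : Type*} [MeasurableSpace Ω] (μ : Measure Ω) [IsProbabilityMeasure μ]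
    {p q m : ℕ} (P : Watermark.Plant p q m) (hP : P.Stable)
    (hlag : ∃ k : ℕ, P.C₁ * (P.A + P.B * P.K) ^ k * P.B ≠ 0)
    (I : Watermark.Inputs Ω p q m) (hI : I.Admissible μ)
    (a : Watermark.Attack Ω p m) (s : Watermark.Signals Ω p m)
    (hpriv : Watermark.PrivateExcitation μ I a s)
    (hloop : Watermark.ClosedLoop P I a s)
    (ρ S : ℝ) (hρ : 0 < ρ) (hS : 0 < S) (τ : ℕ) (hτ : 1 ≤ τ)
    (hswitch : Watermark.SwitchingRule μ P I s ρ S τ)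
    (hnontrivial : ¬ ∀ᵐ ω ∂μ, ∀ n, s.v n ω = 0)
    (hzero : a.γ = 0 → a.IsWhite μ I ∧
      ((∀ᵐ ω ∂μ, s.ξ 0 ω = 0) ∨ ¬ Watermark.ZeroAveragePower μ s.v)) :
    μ (limsup (fun N : ℕ => (Watermark.detection μ P I s ρ S N)ᶜ) atTop) = 0 := by
  have key : ∀ᵐ ω ∂μ, ∀ᶠ N in atTop, ω ∈ Watermark.detection μ P I s ρ S N := by
    by_cases hγ : a.γ = 0
    · exact Watermark.eventually_detection_of_gain_eq_zero hP hI hloop ρ S hγ (hzero hγ).1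
        hnontrivial (hzero hγ).2
    · exact Watermark.eventually_detection_of_gain_ne_zero hP hlag hI hpriv hloop hswitch hγ
  refine measure_mono_null (fun ω hω => ?_) (ae_iff.1 key)
  rw [mem_limsup_iff_frequently_mem] at hω
  exact fun h => hω (h.mono fun N hN hN' => hN' hN)
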